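/- Let $G=H_3(\mathbb R)=\mathbb R^3$ with the product $(x,y,z)(a,b,c)=(x+a,\,y+b,\,z+c+\tfrac12(xb-ay))$, the Cygan–Korányi norm $\|(x,y,z)\|=((x^2+y^2)^2+z^2)^{1/4}$, the left-invariant metric $d(g,h)=\|g^{-1}h\|$, the dilation $D(x,y,z)=(4x,4y,16z)$ (stretch factor $4$), the lattice $\Gamma=H_3(2\mathbb Z)=(2\mathbb Z)^3$ and its fundamental domain $V=[-1,1)^3$. Write $B(e,r)=\{\gamma\in\Gamma: d(\gamma,e)<r\}$, and put $V(0,M)=MV$, $V(n+1,M)=D[(V(n,M)\cap\Gamma)V]$ for $M\subseteq\Gamma$, and $V(n)=V(n,\{e\})$. Let $K=D[V]\cap\Gamma=\{-4,-2,0,2\}^2\times\{-16,-14,\dots,14\}$. Let $\mathcal A=\{a,b\}$ and let $S_0:\mathcal A\to\mathcal A^{K}$ be any substitution rule with the following values, for all $c\in\mathcal A$ and all the points of $K$ that are mentioned: * $S_0(c)(2,2,-16)=c$ and $S_0(c)(2,2,-14)=b$; * $S_0(c)(x,y,-2)=b$ for $(x,y)\ne(0,0)$; * $S_0(c)(0,0,z)=a$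 for all $z$, and $S_0(c)(0,2,z)=a$ for $z\neq-2$; * $S_0(a)=a$ on $\{-2,0\}^2\times\{0,2,\dots,12\}$; * $S_0(b)=b$ on $(-2,-2,6)\cdot(\{-2,0\}^2\times\{-6,-4,\dots,6\})$, i.e. at the points with $x,y\in\{-4,-2\}$ and $|z-6-(x-y)|\le 6$. A patch is a map $P:M\to\mathcal A$, $M\subseteq\Gamma$; a letter is also regarded as a patch with support $\{e\}$. Write $P\prec Q$ if there is $\gamma\in\Gamma$ such that, for every $\eta$ in the support of $P$, $\gamma\eta$ lies in the support of $Q$ and $Q(\gamma\eta)=P(\eta)$. Let $S$ be the substitution map on patches, $S(P)(D(\gamma)\eta)=S_0(P(\gamma))(\eta)$ for $\gamma$ in the support of $P$ and $\eta\in K$. A finite patch $P$ is $S$-legal if $P\prec S^n(c)$ for some $n\ge1$ and $c\in\mathcal A$; $\Omega(S)$ is the set of all $\omega\in\mathcal A^\Gamma$ all of whose finite subpatches are $S$-legal. Let $\Gamma$ act by $(\gamma\omega)(\eta)=\omega(\gamma^{-1}\eta)$, and let $\mathrm{Orb}(\omega)$ be the orbit of $\omega$. Let $\delta_H$ be the Hausdorff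 distance of the metric $\inf\{\frac1{r+1}: r\ge0,\ \omega|_{B(e,r)}=\rho|_{B(e,r)}\}$ on $\mathcal A^\Gamma$. Let $\omega_c$ be the constant configuration with value $c$. Then: (a) $\Omega(S)$ is a subshift (nonempty, closed, $\Gamma$-invariant). It is strongly aperiodic (every element has trivial $\Gamma$-stabilizer) and linearly repetitive: there is $C\ge1$ such that for all $r\ge1$ and $R\ge Cr$, every patch with support $B(e,R)$ occurring in an element of $\Omega(S)$ has as a subpatch every patch with support $B(e,r)$ occurring in an element of $\Omega(S)$. (b) $T=V(1)\cap\Gamma$ is a testing domain: it is finite; for every $r>0$ there is $N_r$ such that for all $n\ge N_r$ and $x\in\Gamma$ there is $\gamma\in\Gamma$ with $xB(e,r)\subseteq D^n(\gamma)V(n,T)$; and there is a smallest integer $m\geq1$ such that for every $x\in\Gamma$ there is $\gamma\in\Gamma$ with $xT\subseteq D^m(\gamma)V(m,T)$. (c) $\Omega(S)$ is periodically approximable: there are configurations $\omega_n$ with finite orbits and $\delta_H(\mathrm{Orb}(\omega_n),\Omega(S))\to0$. More precisely, every $S^n(\omega_c)$ has a finite orbit, and there are $C>0$ and $M_1\ge0$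 such that $\delta_H(\mathrm{Orb}(S^n(\omega_c)),\Omega(S))\le C\cdot4^{-n}$ for all $c\in\mathcal A$ and $n\ge M_1$. -/

import Mathlib

open scoped Pointwise

noncomputable section

/-! ### Symbolic dynamics over a group -/

section Symbolic

variable {Γ A : Type*}

/-- A patch with letters in `A`: a map `P : M → A` on a subset `M` of `Γ`, written as a partial
map; `P γ = none` means that `γ` is not in the support `M`. -/
abbrev Patch (Γ A : Type*) := Γ → Option A

/-- The support of a patch. -/
def patchSupport (P : Patch Γ A) : Set Γ := {γ | P γ ≠ none}

/-- A configuration, regarded as a patch with support `Γ`. -/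
def configPatch (ω : Γ → A) : Patch Γ A := fun γ => some (ω γ)

/-- The action of the group on configurations, `(γ ω)(η) = ω (γ⁻¹ η)`. -/
def shift [Group Γ] (γ : Γ) (ω : Γ → A) : Γ → A := fun η => ω (γ⁻¹ * η)

/-- The orbit of a configuration. -/
def orb [Group Γ] (ω : Γ → A) : Set (Γ → A) := Set.range fun γ : Γ => shift γ ω

/-- The stabilizer of a configuration. -/
def stab [Group Γ] (ω : Γ → A) : Set Γ := {γ | shift γ ω = ω}

/-- A configuration is periodic if its orbit is finite. -/
def IsPeriodicConfig [Group Γ] (ω : Γ → A) : Prop := (orb ω).Finite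

/-- The relation `P ≺ Q`: some translate of `P` is a restriction of `Q`. -/
def IsSubpatch [Group Γ] (P Q : Patch Γ A) : Prop :=
  ∃ γ : Γ, ∀ η ∈ patchSupport P, Q (γ * η) = P η

/-- The dictionary `W(Ω)`: all finite patches that occur in some element of `Ω`. -/
def dictionary [Group Γ] (Ω : Set (Γ → A)) : Set (Patch Γ A) :=
  {P | (patchSupport P).Finite ∧ ∃ ω ∈ Ω, IsSubpatch P (configPatch ω)}

/-- A subshift: a nonempty, closed (for the product topology), invariant set of configurations. -/
def IsSubshift [Group Γ] [TopologicalSpace A] (Ω : Set (Γ → A)) : Prop :=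
  Ω.Nonempty ∧ IsClosed Ω ∧ ∀ γ : Γ, ∀ ω ∈ Ω, shift γ ω ∈ Ω

/-- Every element of `Ω` has trivial stabilizer. -/
def IsStronglyAperiodic [Group Γ] (Ω : Set (Γ → A)) : Prop :=
  ∀ ω ∈ Ω, stab ω = {1}

/-- The open ball `B(e, r)` in `Γ` for the distance function `d`. -/
def ballOne [Group Γ] (d : Γ → Γ → ℝ) (r : ℝ) : Set Γ := {γ | d γ 1 < r}

/-- Linear repetitivity with respect to the distance function `d`. -/
def IsLinearlyRepetitive [Group Γ] (d : Γ → Γ → ℝ) (Ω : Set (Γ → A)) : Prop :=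
  ∃ C : ℝ, 1 ≤ C ∧ ∀ r R : ℝ, 1 ≤ r → C * r ≤ R →
    ∀ P ∈ dictionary Ω, patchSupport P = ballOne d R →
      ∀ Q ∈ dictionary Ω, patchSupport Q = ballOne d r → IsSubpatch Q P

/-- The ultrametric on configurations induced by `d`: the infimum of all `1 / (r + 1)`, `r ≥ 0`,
such that the two configurations agree on `B(e, r)`. -/
def configDist [Group Γ] (d : Γ → Γ → ℝ) (ω ρ : Γ → A) : ℝ :=
  sInf {s | ∃ r : ℝ, 0 ≤ r ∧ (∀ γ ∈ ballOne d r, ω γ = ρ γ) ∧ s = 1 / (r + 1)}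

/-- The Hausdorff distance `δ_H` induced by `configDist`. (Since `configDist` takes values in
`[0, 1]`, all suprema and infima are over bounded families, nonempty if `Ω₁` and `Ω₂` are.) -/
def configHausdorffDist [Group Γ] (d : Γ → Γ → ℝ) (Ω₁ Ω₂ : Set (Γ → A)) : ℝ :=
  max (⨆ ω : Ω₁, ⨅ ρ : Ω₂, configDist d ω.1 ρ.1) (⨆ ρ : Ω₂, ⨅ ω : Ω₁, configDist d ω.1 ρ.1)

/-- `Ω` is a limit, in the Hausdorff distance, of orbits of periodic configurations. -/
def IsPeriodicallyApproximable [Group Γ] (d : Γ → Γ → ℝ) (Ω : Set (Γ → A)) : Prop :=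
  ∃ ω : ℕ → Γ → A, (∀ n, IsPeriodicConfig (ω n)) ∧
    Filter.Tendsto (fun n => configHausdorffDist d (orb (ω n)) Ω) Filter.atTop (nhds 0)

end Symbolic

/-! ### The Heisenberg group and its dilation datum -/

/-- The real Heisenberg group `H₃(ℝ)`, as the set `ℝ³`. -/
@[ext] structure Heis where
  x : ℝ
  y : ℝ
  z : ℝ

namespace Heis

instance : Mul Heis := ⟨fun g h => ⟨g.x + h.x, g.y + h.y, g.z + h.z + 1 / 2 * (g.x * h.y - h.x * g.y)⟩⟩
instance : One Heis := ⟨⟨0, 0, 0⟩⟩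
instance : Inv Heis := ⟨fun g => ⟨-g.x, -g.y, -g.z⟩⟩

@[simp] theorem mul_x (g h : Heis) : (g * h).x = g.x + h.x := rfl
@[simp] theorem mul_y (g h : Heis) : (g * h).y = g.y + h.y := rfl
@[simp] theorem mul_z (g h : Heis) :
    (g * h).z = g.z + h.z + 1 / 2 * (g.x * h.y - h.x * g.y) := rfl
@[simp] theorem one_x : (1 : Heis).x = 0 := rfl
@[simp] theorem one_y : (1 : Heis).y = 0 := rfl
@[simp] theorem one_z : (1 : Heis).z = 0 := rfl
@[simp] theorem inv_x (g : Heis) : g⁻¹.x = -g.x := rfl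
@[simp] theorem inv_y (g : Heis) : g⁻¹.y = -g.y := rfl
@[simp] theorem inv_z (g : Heis) : g⁻¹.z = -g.z := rfl

instance : Group Heis where
  mul_assoc g h k := by ext <;> simp <;> ring
  one_mul g := by ext <;> simp
  mul_one g := by ext <;> simp
  inv_mul_cancel g := by ext <;> simp [mul_comm]

/-- The Cygan-Korányi norm. -/
def ckNorm (g : Heis) : ℝ := ((g.x ^ 2 + g.y ^ 2) ^ 2 + g.z ^ 2) ^ (1 / 4 : ℝ)

/-- The dilation `D_t (x, y, z) = (t x, t y, t² z)`. -/
def dil (t : ℝ) : Heis →* Heis where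
  toFun g := ⟨t * g.x, t * g.y, t ^ 2 * g.z⟩
  map_one' := by ext <;> simp
  map_mul' g h := by ext <;> simp <;> ring

@[simp] theorem dil_x (t : ℝ) (g : Heis) : (dil t g).x = t * g.x := rfl
@[simp] theorem dil_y (t : ℝ) (g : Heis) : (dil t g).y = t * g.y := rfl
@[simp] theorem dil_z (t : ℝ) (g : Heis) : (dil t g).z = t ^ 2 * g.z := rfl

/-- The lattice `Γ = H₃(2ℤ)` of all points with coordinates in `2ℤ`. -/
def lattice : Subgroup Heis where
  carrier := {g | ∃ i j k : ℤ, g = ⟨2 * i, 2 * j, 2 * k⟩}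
  one_mem' := ⟨0, 0, 0, by ext <;> simp⟩
  mul_mem' := by
    rintro _ _ ⟨i, j, k, rfl⟩ ⟨a, b, c, rfl⟩
    exact ⟨i + a, j + b, k + c + (i * b - a * j), by ext <;> simp <;> ring⟩
  inv_mem' := by
    rintro _ ⟨i, j, k, rfl⟩
    exact ⟨-i, -j, -k, by ext <;> simp⟩

/-- The fundamental domain `V = [-1, 1)³`. -/
def domV : Set Heis :=
  {g | g.x ∈ Set.Ico (-1 : ℝ) 1 ∧ g.y ∈ Set.Ico (-1 : ℝ) 1 ∧ g.z ∈ Set.Ico (-1 : ℝ) 1}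

theorem floor_spec (t : ℝ) : t - 2 * (⌊(t + 1) / 2⌋ : ℝ) ∈ Set.Ico (-1 : ℝ) 1 := by
  have h1 := Int.floor_le ((t + 1) / 2)
  have h2 := Int.lt_floor_add_one ((t + 1) / 2)
  constructor <;> linarith

theorem floor_unique (t : ℝ) (n : ℤ) (h : t - 2 * (n : ℝ) ∈ Set.Ico (-1 : ℝ) 1) :
    n = ⌊(t + 1) / 2⌋ := by
  symm
  rw [Int.floor_eq_iff]
  constructor <;> linarith [h.1, h.2]

/-- `V` is a left-fundamental domain: `G` is the disjoint union of the sets `γ V`, `γ ∈ Γ`. -/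
theorem exists_unique_lattice (g : Heis) :
    ∃! γ : lattice, ((γ : Heis)⁻¹ * g) ∈ domV := by
  refine ⟨⟨⟨2 * (⌊(g.x + 1) / 2⌋ : ℤ), 2 * (⌊(g.y + 1) / 2⌋ : ℤ),
    2 * (⌊(g.z + (⌊(g.y + 1) / 2⌋ * g.x - ⌊(g.x + 1) / 2⌋ * g.y) + 1) / 2⌋ : ℤ)⟩,
    ⟨_, _, _, rfl⟩⟩, ⟨?_, ?_, ?_⟩, ?_⟩
  · have := floor_spec g.x
    simpa [sub_eq_add_neg, add_comm] using this
  · have := floor_spec g.y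
    simpa [sub_eq_add_neg, add_comm] using this
  · have := floor_spec (g.z + (⌊(g.y + 1) / 2⌋ * g.x - ⌊(g.x + 1) / 2⌋ * g.y))
    convert this using 1
    simp
    ring
  · rintro ⟨_, i, j, k, rfl⟩ ⟨h1, h2, h3⟩
    have e1 : i = ⌊(g.x + 1) / 2⌋ := floor_unique _ _ (by
      convert h1 using 1; simp; ring)
    have e2 : j = ⌊(g.y + 1) / 2⌋ := floor_unique _ _ (by
      convert h2 using 1; simp; ring)
    subst e1 e2
    have e3 := floor_unique (g.z + (⌊(g.y + 1) / 2⌋ * g.x - ⌊(g.x + 1) / 2⌋ * g.y)) k (by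
      convert h3 using 1; simp; ring)
    subst e3
    rfl

/-- The left-invariant distance `d(g, h) = ‖g⁻¹ h‖` of the Cygan-Korányi norm, restricted to the
lattice. -/
def latticeDist (γ η : lattice) : ℝ := ckNorm ((γ : Heis)⁻¹ * η)

/-- The dilation with stretch factor `4`. -/
def D : Heis →* Heis := dil 4

theorem D_mem_lattice {g : Heis} (hg : g ∈ lattice) : D g ∈ lattice := by
  obtain ⟨i, j, k, rfl⟩ := hg
  exact ⟨4 * i, 4 * j, 16 * k, by ext <;> simp [D] <;> ring⟩

/-- The dilation with stretch factor `4` as a map `Γ → Γ`. -/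
def latticeD (γ : lattice) : lattice := ⟨D γ, D_mem_lattice γ.2⟩

/-- The sets `V(n, M)`: `V(0, M) = M V` and `V(n + 1, M) = D[(V(n, M) ∩ Γ) V]`. -/
def levelSet : ℕ → Set Heis → Set Heis
  | 0, M => M * domV
  | n + 1, M => D '' ((levelSet n M ∩ lattice) * domV)

/-- `(T, N)` is a testing tuple for the dilation datum with stretch factor `4`. -/
def IsTestingTuple (T : Set Heis) (N : ℕ) : Prop :=
  T ⊆ lattice ∧ T.Finite ∧
    (∀ r : ℝ, 0 < r → ∃ N_r : ℕ, ∀ n ≥ N_r, ∀ x ∈ lattice, ∃ γ ∈ lattice,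
      x • (Subtype.val '' ballOne latticeDist r) ⊆ (D^[n] γ) • levelSet n T) ∧
    IsLeast {m : ℕ | 1 ≤ m ∧ ∀ x ∈ lattice, ∃ γ ∈ lattice,
      x • T ⊆ (D^[m] γ) • levelSet m T} N

/-- `T` is a testing domain for the dilation datum with stretch factor `4`. -/
def IsTestingDomain (T : Set Heis) : Prop := ∃ N : ℕ, IsTestingTuple T N

/-! ### Substitutions with stretch factor `4` on the lattice -/

/-- The finite set `D[V] ∩ Γ`, on which the images of letters are defined. -/
def block : Set lattice := {η | (η : Heis) ∈ D '' domV}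

theorem exists_unique_cell (ξ : lattice) : ∃! γ : lattice, (latticeD γ)⁻¹ * ξ ∈ block := by
  have key : ∀ γ : lattice, (latticeD γ)⁻¹ * ξ ∈ block ↔
      (γ : Heis)⁻¹ * (dil (1 / 4) ξ) ∈ domV := by
    intro γ
    have h : D ((γ : Heis)⁻¹ * dil (1 / 4) ξ) = ((latticeD γ)⁻¹ * ξ : lattice) := by
      rw [map_mul]
      congr 1
      · simp [latticeD]
      · ext <;> simp [D]
    constructor
    · rintro ⟨v, hv, e⟩
      rw [← h] at e
      have : v = (γ : Heis)⁻¹ * dil (1 / 4) ξ := by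
        have ex := congrArg Heis.x e
        have ey := congrArg Heis.y e
        have ez := congrArg Heis.z e
        simp only [D, dil_x, dil_y, dil_z] at ex ey ez
        ext
        · linarith
        · linarith
        · linarith
      rwa [← this]
    · intro hv
      exact ⟨_, hv, h⟩
  simpa only [key] using exists_unique_lattice (dil (1 / 4) ξ)

/-- The unique `γ ∈ Γ` such that `ξ ∈ D(γ) (D[V] ∩ Γ)`. -/
def cell (ξ : lattice) : lattice := (exists_unique_cell ξ).choose

/-- The position `D(γ)⁻¹ ξ ∈ D[V] ∩ Γ` of `ξ` in its cell. -/
def cellPos (ξ : lattice) : block :=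
  ⟨(latticeD (cell ξ))⁻¹ * ξ, (exists_unique_cell ξ).choose_spec.1⟩

theorem cell_mul (γ : lattice) (η : block) : cell (latticeD γ * η) = γ :=
  ((exists_unique_cell (latticeD γ * η)).choose_spec.2 γ (by simp)).symm

theorem cellPos_mul (γ : lattice) (η : block) : cellPos (latticeD γ * η) = η := by
  apply Subtype.ext
  simp [cellPos, cell_mul]

variable {A : Type*}

/-- The substitution map `S` on patches given by the substitution rule `S₀ : A → A ^ (D[V] ∩ Γ)`:
every letter `c` at `γ` is replaced by the patch `S₀ c` translated by `D(γ)`. -/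
def substPatch (S₀ : A → block → A) (P : Patch lattice A) : Patch lattice A :=
  fun ξ => (P (cell ξ)).map fun c => S₀ c (cellPos ξ)

/-- The substitution map `S` on configurations. -/
def substConfig (S₀ : A → block → A) (ω : lattice → A) : lattice → A :=
  fun ξ => S₀ (ω (cell ξ)) (cellPos ξ)

theorem substPatch_apply (S₀ : A → block → A) (P : Patch lattice A) (γ : lattice) (η : block) :
    substPatch S₀ P (latticeD γ * η) = (P γ).map fun c => S₀ c η := by
  simp [substPatch, cell_mul, cellPos_mul]

theorem substPatch_configPatch (S₀ : A → block → A) (ω : lattice → A) :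
    substPatch S₀ (configPatch ω) = configPatch (substConfig S₀ ω) := rfl

open Classical in
/-- A letter, regarded as a patch with support `{e}`. -/
def letterPatch (c : A) : Patch lattice A := fun γ => if γ = 1 then some c else none

/-- The set `W(S)` of `S`-legal patches: the finite `P` with `P ≺ Sⁿ(c)` for a letter `c` and some
`n ≥ 1`. -/
def legalPatches (S₀ : A → block → A) : Set (Patch lattice A) :=
  {P | (patchSupport P).Finite ∧
    ∃ (n : ℕ) (c : A), 1 ≤ n ∧ IsSubpatch P ((substPatch S₀)^[n] (letterPatch c))}

/-- The subshift `Ω(S)` of all configurations whose finite patches are `S`-legal. -/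
def substSubshift (S₀ : A → block → A) : Set (lattice → A) :=
  {ω | dictionary {ω} ⊆ legalPatches S₀}

end Heis

/-- The two-letter alphabet, with the discrete topology. -/
inductive Letter
  | a
  | b

instance : TopologicalSpace Letter := ⊥

instance : DiscreteTopology Letter := ⟨rfl⟩

/-- The substitution rules on `{a, b}` with the prescribed letters. (All points of the block have
coordinates in `2ℤ`, with `x, y ∈ {-4, -2, 0, 2}` and `z ∈ {-16, -14, …, 14}`.) -/
structure IsHeisRule (S₀ : Letter → Heis.block → Letter) : Prop where
  /-- the marker that remembers the letter -/
  marker : ∀ (c : Letter) (η : Heis.block), η.1.1 = ⟨2, 2, -16⟩ → S₀ c η = c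
  /-- the letter `b` next to the marker -/
  next_marker : ∀ (c : Letter) (η : Heis.block), η.1.1 = ⟨2, 2, -14⟩ → S₀ c η = Letter.b
  /-- the layer `z = -2` carries `b`, except on the central axis -/
  layer : ∀ (c : Letter) (η : Heis.block), η.1.1.z = -2 → ¬ (η.1.1.x = 0 ∧ η.1.1.y = 0) →
    S₀ c η = Letter.b
  /-- the central axis carries `a` -/
  axis : ∀ (c : Letter) (η : Heis.block), η.1.1.x = 0 → η.1.1.y = 0 → S₀ c η = Letter.a
  /-- the line over `(0, 2)` carries `a`, except in the layer `z = -2` -/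
  line : ∀ (c : Letter) (η : Heis.block), η.1.1.x = 0 → η.1.1.y = 2 → η.1.1.z ≠ -2 →
    S₀ c η = Letter.a
  /-- `S₀ a` is equal to `a` on `{-2, 0}² × {0, 2, …, 12}` -/
  a_box : ∀ η : Heis.block, (η.1.1.x = -2 ∨ η.1.1.x = 0) → (η.1.1.y = -2 ∨ η.1.1.y = 0) →
    0 ≤ η.1.1.z → η.1.1.z ≤ 12 → S₀ Letter.a η = Letter.a
  /-- `S₀ b` is equal to `b` on `(-2, -2, 6) · ({-2, 0}² × {-6, -4, …, 6})` -/
  b_box : ∀ η : Heis.block, (η.1.1.x = -4 ∨ η.1.1.x = -2) → (η.1.1.y = -4 ∨ η.1.1.y = -2) →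
    |η.1.1.z - 6 - (η.1.1.x - η.1.1.y)| ≤ 6 → S₀ Letter.b η = Letter.b

end

noncomputable section

/-! Iterating `cell` sends a point to the index of the n-th order supertile containing it. The
shapes of supertiles are never computed: after rescaling by 4⁻ⁿ, the position of a point relative to
its index stays in the fixed bounded set `tileHull`. Three estimates follow. A ball of radius r ≤
4ⁿ/10 meets only supertiles with indices in one translate of the finite set `core`
(`exists_iterate_cell_mem_core`). The supertiles at e exhaust Γ. A supertile of order n has diameter
less than 4·4ⁿ.

Every image of a letter carries `a` at e, so the patches Sⁿ(a) are nested and converge to a fixed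
configuration ω₀. Every image contains both letters, so every Sⁿ(c) occurs in ω₀ and Ω(S) is the
orbit closure of ω₀ (`substSubshift_eq_closure_orb`).

Aperiodicity rests on recognizability (`exists_latticeD_eq_of_substConfig_mul`): a translation
between two substituted configurations lies in D(Γ) and descends to the preimages. A period is then
conjugate into Dⁿ(Γ) for every n, hence trivial.

Repetitivity and approximation come from the same counting. A ball pattern of radius r is determined
by a core pattern, there are finitely many of those, and all of them appear in Sᵐ(c) for one m and
every c. Conversely, the patterns of Sⁿ(ω_c) on balls of radius 4ⁿ/10 come from the constant core
pattern c, which occurs in ω₀ because of the prescribed boxes of equal letters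
(`exists_core_pattern_const`). -/

instance : Finite Letter :=
  Finite.of_surjective (fun t : Bool => if t then Letter.a else Letter.b) fun c => by
    cases c
    · exact ⟨true, rfl⟩
    · exact ⟨false, rfl⟩

namespace Heis

/-! ### Coordinates of lattice points -/

/-- The lattice point with coordinates `2 i, 2 j, 2 k`. -/
def latticeMk (i j k : ℤ) : lattice := ⟨⟨2 * i, 2 * j, 2 * k⟩, i, j, k, rfl⟩

theorem latticeMk_surjective (ξ : lattice) : ∃ i j k : ℤ, ξ = latticeMk i j k := by
  obtain ⟨_, i, j, k, rfl⟩ := ξ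
  exact ⟨i, j, k, rfl⟩

theorem latticeMk_eq_iff {i j k i' j' k' : ℤ} :
    latticeMk i j k = latticeMk i' j' k' ↔ i = i' ∧ j = j' ∧ k = k' := by
  constructor
  · intro h
    have h' : (⟨2 * i, 2 * j, 2 * k⟩ : Heis) = ⟨2 * i', 2 * j', 2 * k'⟩ := congrArg Subtype.val h
    simp only [Heis.mk.injEq] at h'
    obtain ⟨h1, h2, h3⟩ := h'
    refine ⟨?_, ?_, ?_⟩
    · exact_mod_cast (by linarith : (i : ℝ) = i')
    · exact_mod_cast (by linarith : (j : ℝ) = j')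
    · exact_mod_cast (by linarith : (k : ℝ) = k')
  · rintro ⟨rfl, rfl, rfl⟩
    rfl

theorem latticeMk_one : latticeMk 0 0 0 = 1 := by
  apply Subtype.ext
  ext <;> simp [latticeMk]

theorem latticeMk_mul (i j k a b c : ℤ) :
    latticeMk i j k * latticeMk a b c = latticeMk (i + a) (j + b) (k + c + (i * b - a * j)) := by
  apply Subtype.ext
  ext <;> simp [latticeMk] <;> ring

theorem latticeD_mk (i j k : ℤ) : latticeD (latticeMk i j k) = latticeMk (4 * i) (4 * j) (16 * k) := by
  apply Subtype.ext
  ext <;> simp [latticeMk, latticeD, D] <;> ring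

theorem latticeD_mul (γ η : lattice) : latticeD (γ * η) = latticeD γ * latticeD η :=
  Subtype.ext (map_mul D (γ : Heis) η)

theorem latticeD_one : latticeD 1 = 1 := Subtype.ext (map_one D)

theorem iterate_latticeD_mul (n : ℕ) (γ η : lattice) :
    latticeD^[n] (γ * η) = latticeD^[n] γ * latticeD^[n] η := by
  induction n with
  | zero => rfl
  | succ n ih => simp only [Function.iterate_succ_apply', ih, latticeD_mul]

theorem iterate_latticeD_one (n : ℕ) : latticeD^[n] 1 = 1 :=
  Function.iterate_fixed latticeD_one n

theorem iterate_latticeD_inv (n : ℕ) (γ : lattice) :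
    latticeD^[n] γ⁻¹ = (latticeD^[n] γ)⁻¹ := by
  rw [eq_inv_iff_mul_eq_one, ← iterate_latticeD_mul, inv_mul_cancel, iterate_latticeD_one]

theorem iterate_latticeD_mk (n : ℕ) (i j k : ℤ) :
    latticeD^[n] (latticeMk i j k) = latticeMk (4 ^ n * i) (4 ^ n * j) (16 ^ n * k) := by
  induction n with
  | zero => simp
  | succ n ih =>
    rw [Function.iterate_succ_apply', ih, latticeD_mk, latticeMk_eq_iff]
    refine ⟨?_, ?_, ?_⟩ <;> ring

theorem coe_iterate_latticeD (n : ℕ) (γ : lattice) :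
    ((latticeD^[n] γ : lattice) : Heis) = D^[n] γ := by
  induction n with
  | zero => rfl
  | succ n ih => rw [Function.iterate_succ_apply', Function.iterate_succ_apply', ← ih]; rfl

theorem finite_lattice_box (a b c : ℝ) :
    {ξ : lattice | |ξ.1.x| ≤ a ∧ |ξ.1.y| ≤ b ∧ |ξ.1.z| ≤ c}.Finite := by
  refine ((((Set.finite_Icc (-⌈a⌉) ⌈a⌉).prod ((Set.finite_Icc (-⌈b⌉) ⌈b⌉).prod
    (Set.finite_Icc (-⌈c⌉) ⌈c⌉)))).image fun t => latticeMk t.1 t.2.1 t.2.2).subset ?_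
  have aux : ∀ (i : ℤ) (s : ℝ), |2 * (i : ℝ)| ≤ s → i ∈ Set.Icc (-⌈s⌉) ⌈s⌉ := by
    intro i s h
    have h1 := Int.le_ceil s
    have h2 : |(i : ℝ)| ≤ ⌈s⌉ := by
      rw [abs_mul, abs_two] at h
      linarith [abs_nonneg (i : ℝ)]
    exact abs_le.1 (by exact_mod_cast h2)
  rintro ξ ⟨h1, h2, h3⟩
  obtain ⟨i, j, k, rfl⟩ := latticeMk_surjective ξ
  exact ⟨(i, j, k), ⟨aux _ _ h1, aux _ _ h2, aux _ _ h3⟩, rfl⟩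

/-! ### Cells -/

theorem latticeMk_mem_block {i j k : ℤ} :
    latticeMk i j k ∈ block ↔ (-2 ≤ i ∧ i ≤ 1) ∧ (-2 ≤ j ∧ j ≤ 1) ∧ -8 ≤ k ∧ k ≤ 7 := by
  constructor
  · rintro ⟨v, ⟨hx, hy, hz⟩, e⟩
    have ex := congrArg Heis.x e
    have ey := congrArg Heis.y e
    have ez := congrArg Heis.z e
    simp only [D, dil_x, dil_y, dil_z, latticeMk] at ex ey ez
    have h1 : (-2 : ℝ) ≤ i := by linarith [hx.1]
    have h2 : (i : ℝ) < 2 := by linarith [hx.2]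
    have h3 : (-2 : ℝ) ≤ j := by linarith [hy.1]
    have h4 : (j : ℝ) < 2 := by linarith [hy.2]
    have h5 : (-8 : ℝ) ≤ k := by linarith [hz.1]
    have h6 : (k : ℝ) < 8 := by linarith [hz.2]
    norm_cast at h1 h2 h3 h4 h5 h6
    omega
  · rintro ⟨⟨h1, h2⟩, ⟨h3, h4⟩, h5, h6⟩
    have h1' : (-2 : ℝ) ≤ i := by exact_mod_cast h1
    have h2' : (i : ℝ) ≤ 1 := by exact_mod_cast h2
    have h3' : (-2 : ℝ) ≤ j := by exact_mod_cast h3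
    have h4' : (j : ℝ) ≤ 1 := by exact_mod_cast h4
    have h5' : (-8 : ℝ) ≤ k := by exact_mod_cast h5
    have h6' : (k : ℝ) ≤ 7 := by exact_mod_cast h6
    refine ⟨⟨i / 2, j / 2, k / 8⟩, ⟨⟨?_, ?_⟩, ⟨?_, ?_⟩, ?_, ?_⟩, ?_⟩
    iterate 6 (dsimp only; linarith)
    ext <;> simp [D, latticeMk] <;> ring

/-- The point of the block with coordinates `2 i, 2 j, 2 k`. -/
def blockMk (i j k : ℤ) (h : (-2 ≤ i ∧ i ≤ 1) ∧ (-2 ≤ j ∧ j ≤ 1) ∧ -8 ≤ k ∧ k ≤ 7) : block :=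
  ⟨latticeMk i j k, latticeMk_mem_block.2 h⟩

theorem blockMk_surjective (η : block) : ∃ i j k h, η = blockMk i j k h := by
  obtain ⟨ξ, hξ⟩ := η
  obtain ⟨i, j, k, rfl⟩ := latticeMk_surjective ξ
  exact ⟨i, j, k, latticeMk_mem_block.1 hξ, rfl⟩

theorem latticeD_cell_mul_cellPos (ξ : lattice) : latticeD (cell ξ) * cellPos ξ = ξ := by
  simp [cellPos]

theorem cell_block (η : block) : cell η = 1 := by
  have := cell_mul 1 η
  rwa [latticeD_one, one_mul] at this

theorem cell_latticeD_mul (γ ξ : lattice) : cell (latticeD γ * ξ) = γ * cell ξ := by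
  conv_lhs => rw [← latticeD_cell_mul_cellPos ξ, ← mul_assoc, ← latticeD_mul, cell_mul]

theorem cellPos_latticeD_mul (γ ξ : lattice) : cellPos (latticeD γ * ξ) = cellPos ξ := by
  conv_lhs => rw [← latticeD_cell_mul_cellPos ξ, ← mul_assoc, ← latticeD_mul, cellPos_mul]

theorem iterate_cell_mul (n : ℕ) (γ ξ : lattice) :
    cell^[n] (latticeD^[n] γ * ξ) = γ * cell^[n] ξ := by
  induction n generalizing ξ with
  | zero => rfl
  | succ n ih =>
    rw [Function.iterate_succ_apply, Function.iterate_succ_apply', cell_latticeD_mul, ih,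
      Function.iterate_succ_apply]

theorem iterate_cell_one (n : ℕ) : cell^[n] 1 = 1 :=
  Function.iterate_fixed (by
    simpa [blockMk, latticeMk_one] using cell_block (blockMk 0 0 0 (by norm_num))) n

/-! ### Comparison of iterated cells with dilations -/

/-- A bounded set absorbing the rescaled positions in iterated cells. -/
def tileHull : Set Heis :=
  {h | h.x ∈ Set.Icc (-4 / 3 : ℝ) (2 / 3) ∧ h.y ∈ Set.Icc (-4 / 3 : ℝ) (2 / 3) ∧ |h.z| ≤ 3 / 2}

theorem abs_mul_le_mul_of_le {a b s t : ℝ} (h1 : |a| ≤ s) (h2 : |b| ≤ t) : |a * b| ≤ s * t := by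
  rw [abs_mul]
  exact mul_le_mul h1 h2 (abs_nonneg _) ((abs_nonneg _).trans h1)

/-- Block coordinates x, y lie in [-4, 2], and the interval [-4/3, 2/3] solves -4/3 = (-4 - 4/3)/4
and 2/3 = (2 + 2/3)/4. For z, the commutator term is at most 16/3, and (16 + 3/2 + 16/3)/16 < 3/2.
-/
theorem dil_block_mul_mem_tileHull (η : block) {h : Heis} (hh : h ∈ tileHull) :
    dil (1 / 4) (η.1.1 * h) ∈ tileHull := by
  obtain ⟨i, j, k, ⟨⟨h1, h2⟩, ⟨h3, h4⟩, h5, h6⟩, rfl⟩ := blockMk_surjective η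
  have h1' : (-2 : ℝ) ≤ i := by exact_mod_cast h1
  have h2' : (i : ℝ) ≤ 1 := by exact_mod_cast h2
  have h3' : (-2 : ℝ) ≤ j := by exact_mod_cast h3
  have h4' : (j : ℝ) ≤ 1 := by exact_mod_cast h4
  have h5' : (-8 : ℝ) ≤ k := by exact_mod_cast h5
  have h6' : (k : ℝ) ≤ 7 := by exact_mod_cast h6
  obtain ⟨⟨x1, x2⟩, ⟨y1, y2⟩, hz⟩ := hh
  have e1 := abs_le.1 (abs_mul_le_mul_of_le (a := i) (b := h.y) (s := 2) (t := 4 / 3)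
    (abs_le.2 ⟨by linarith, by linarith⟩) (abs_le.2 ⟨by linarith, by linarith⟩))
  have e2 := abs_le.1 (abs_mul_le_mul_of_le (a := h.x) (b := j) (s := 4 / 3) (t := 2)
    (abs_le.2 ⟨by linarith, by linarith⟩) (abs_le.2 ⟨by linarith, by linarith⟩))
  rw [abs_le] at hz
  refine ⟨⟨?_, ?_⟩, ⟨?_, ?_⟩, abs_le.2 ⟨?_, ?_⟩⟩ <;>
    simp only [blockMk, latticeMk, dil_x, dil_y, dil_z, mul_x, mul_y, mul_z] <;> linarith

theorem iterate_cell_inv_mul_dil_mem (n : ℕ) (ξ : lattice) :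
    ((cell^[n] ξ : lattice) : Heis)⁻¹ * dil ((1 / 4) ^ n) ξ ∈ tileHull := by
  induction n with
  | zero =>
    have : ((cell^[0] ξ : lattice) : Heis)⁻¹ * dil ((1 / 4) ^ 0) ξ = 1 := by
      have : dil ((1 / 4) ^ 0) (ξ : Heis) = ξ := by ext <;> simp
      rw [this, Function.iterate_zero_apply, inv_mul_cancel]
    rw [this]
    refine ⟨⟨?_, ?_⟩, ⟨?_, ?_⟩, ?_⟩ <;> norm_num
  | succ n ih =>
    have key := dil_block_mul_mem_tileHull (cellPos (cell^[n] ξ)) ih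
    rw [Function.iterate_succ_apply']
    convert key using 1
    have h1 : ((cellPos (cell^[n] ξ)).1 : Heis) =
        (D (cell (cell^[n] ξ) : Heis))⁻¹ * (cell^[n] ξ : lattice) := rfl
    rw [h1, mul_assoc, mul_inv_cancel_left, map_mul, map_inv]
    congr 1
    · congr 1
      ext <;> simp [D]
    · ext <;> simp <;> ring

end Heis
namespace Heis

/-! ### Balls of the Cygan-Korányi norm -/

theorem ckNorm_lt_iff {g : Heis} {r : ℝ} (hr : 0 ≤ r) :
    ckNorm g < r ↔ (g.x ^ 2 + g.y ^ 2) ^ 2 + g.z ^ 2 < r ^ 4 := by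
  have h := Real.rpow_inv_lt_iff_of_pos (x := (g.x ^ 2 + g.y ^ 2) ^ 2 + g.z ^ 2) (y := r) (z := 4)
    (by positivity) hr (by norm_num)
  have e : r ^ (4 : ℝ) = r ^ 4 := by exact_mod_cast Real.rpow_natCast r 4
  rw [ckNorm, one_div, h, e]

theorem mem_ballOne_iff {u : lattice} {r : ℝ} :
    u ∈ ballOne latticeDist r ↔ 0 ≤ r ∧ (u.1.x ^ 2 + u.1.y ^ 2) ^ 2 + u.1.z ^ 2 < r ^ 4 := by
  have e : latticeDist u 1 = ckNorm (u : Heis)⁻¹ := by simp [latticeDist]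
  rw [ballOne, Set.mem_ofPred_eq, e]
  constructor
  · intro h
    have h0 : 0 ≤ ckNorm (u : Heis)⁻¹ := Real.rpow_nonneg (by positivity) _
    have hr : 0 ≤ r := h0.trans h.le
    exact ⟨hr, by simpa using (ckNorm_lt_iff hr).1 h⟩
  · rintro ⟨hr, h⟩
    exact (ckNorm_lt_iff hr).2 (by simpa using h)

theorem abs_le_of_mem_ballOne {u : lattice} {r : ℝ} (hu : u ∈ ballOne latticeDist r) :
    |u.1.x| ≤ r ∧ |u.1.y| ≤ r ∧ |u.1.z| ≤ r ^ 2 := by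
  obtain ⟨hr, h⟩ := mem_ballOne_iff.1 hu
  have hz : u.1.z ^ 2 ≤ (r ^ 2) ^ 2 := by nlinarith [sq_nonneg (u.1.x ^ 2 + u.1.y ^ 2)]
  have hxy : u.1.x ^ 2 + u.1.y ^ 2 ≤ r ^ 2 :=
    le_of_sq_le_sq (by nlinarith [sq_nonneg u.1.z]) (by positivity)
  exact ⟨abs_le_of_sq_le_sq (by nlinarith [sq_nonneg u.1.y]) hr,
    abs_le_of_sq_le_sq (by nlinarith [sq_nonneg u.1.x]) hr,
    abs_le_of_sq_le_sq hz (by positivity)⟩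

theorem finite_ballOne (r : ℝ) : (ballOne latticeDist r).Finite :=
  (finite_lattice_box r r (r ^ 2)).subset fun _ hu => abs_le_of_mem_ballOne hu

/-! ### Balls and supertiles -/

/-- The set `{-2, 0}² × {-6, -4, …, 6}`. -/
def core : Set lattice :=
  {t | (t.1.x = -2 ∨ t.1.x = 0) ∧ (t.1.y = -2 ∨ t.1.y = 0) ∧ |t.1.z| ≤ 6}

theorem finite_core : core.Finite := by
  refine (finite_lattice_box 2 2 6).subset ?_
  rintro t ⟨hx, hy, hz⟩
  refine ⟨?_, ?_, hz⟩
  · rcases hx with h | h <;> norm_num [h]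
  · rcases hy with h | h <;> norm_num [h]

/-- After rescaling by 4⁻ⁿ the ball is almost a point, so the supertile indices vary only by the
extent of `tileHull`. That only `core` is met, whatever n is, makes all later finiteness arguments
uniform. -/
theorem exists_iterate_cell_mem_core (n : ℕ) (x : lattice) {r : ℝ} (hr : 10 * r ≤ 4 ^ n) :
    ∃ γ : lattice, ∀ u ∈ ballOne latticeDist r, γ⁻¹ * cell^[n] (x * u) ∈ core := by
  set g : Heis := dil ((1 / 4) ^ n) x with hg
  -- The shift by 1/2 puts the rescaled centre in [-3/2, 1/2) in x and y. With the hull and the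
  -- error 1/10, the index coordinates then lie in (-4, 2), leaving only the even values -2 and 0.
  obtain ⟨γ, hγ, -⟩ := exists_unique_lattice (g * ⟨1 / 2, 1 / 2, 0⟩)
  refine ⟨γ, fun u hu => ?_⟩
  have hγ' : ((γ : Heis)⁻¹ * g) * ⟨1 / 2, 1 / 2, 0⟩ ∈ domV := by rwa [mul_assoc]
  set c : Heis := (γ : Heis)⁻¹ * g with hc
  set h : Heis := ((cell^[n] (x * u) : lattice) : Heis)⁻¹ * dil ((1 / 4) ^ n) (x * u : lattice)
    with hh
  have hA : h ∈ tileHull := iterate_cell_inv_mul_dil_mem n (x * u)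
  set v : Heis := dil ((1 / 4) ^ n) u with hv
  set w : lattice := γ⁻¹ * cell^[n] (x * u) with hw
  have key : (w : Heis) * h = c * v := by
    have : ((x * u : lattice) : Heis) = x * u := rfl
    rw [hw, hh, hc, hg, hv, this, map_mul]
    simp only [Subgroup.coe_mul, Subgroup.coe_inv]
    group
  obtain ⟨ux, uy, uz⟩ := abs_le_of_mem_ballOne hu
  have hr0 : 0 ≤ r := (abs_nonneg _).trans ux
  have hs : (1 / 4 : ℝ) ^ n * r ≤ 1 / 10 := by
    rw [one_div_pow, one_div_mul_eq_div, div_le_iff₀ (by positivity)]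
    linarith
  have hs0 : (0 : ℝ) ≤ (1 / 4 : ℝ) ^ n := by positivity
  have vx : |v.x| ≤ 1 / 10 := by
    rw [hv, dil_x, abs_mul, abs_of_nonneg hs0]
    exact (mul_le_mul_of_nonneg_left ux hs0).trans hs
  have vy : |v.y| ≤ 1 / 10 := by
    rw [hv, dil_y, abs_mul, abs_of_nonneg hs0]
    exact (mul_le_mul_of_nonneg_left uy hs0).trans hs
  have vz : |v.z| ≤ 1 / 100 := by
    rw [hv, dil_z, abs_mul, abs_of_nonneg (by positivity)]
    refine (mul_le_mul_of_nonneg_left uz (by positivity)).trans ?_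
    rw [← mul_pow]
    exact (pow_le_pow_left₀ (by positivity) hs 2).trans (by norm_num)
  obtain ⟨⟨cx1, cx2⟩, ⟨cy1, cy2⟩, cz1, cz2⟩ := hγ'
  obtain ⟨⟨hx1, hx2⟩, ⟨hy1, hy2⟩, hz⟩ := hA
  have kx := congrArg Heis.x key
  have ky := congrArg Heis.y key
  have kz := congrArg Heis.z key
  simp only [mul_x, mul_y, mul_z] at kx ky kz cx1 cx2 cy1 cy2 cz1 cz2
  have b1 := abs_le.1 (abs_mul_le_mul_of_le (a := c.x) (s := 3 / 2)
    (abs_le.2 ⟨by linarith, by linarith⟩) vy)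
  have b2 := abs_le.1 (abs_mul_le_mul_of_le vx (b := c.y) (t := 3 / 2)
    (abs_le.2 ⟨by linarith, by linarith⟩))
  rw [abs_le] at vx vy vz hz
  have even : ∀ i : ℤ, (-4 : ℝ) < 2 * i → 2 * (i : ℝ) < 2 →
      2 * (i : ℝ) = -2 ∨ 2 * (i : ℝ) = 0 := by
    intro i h1 h2
    have h1' : (-4 : ℤ) < 2 * i := by exact_mod_cast h1
    have h2' : 2 * i < (2 : ℤ) := by exact_mod_cast h2
    obtain rfl | rfl : i = -1 ∨ i = 0 := by omega
    · left; norm_num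
    · right; norm_num
  obtain ⟨i, j, k, hijk⟩ := latticeMk_surjective w
  rw [hijk] at kx ky kz ⊢
  simp only [latticeMk] at kx ky kz
  have hi := even i (by linarith) (by linarith)
  have hj := even j (by linarith) (by linarith)
  refine ⟨hi, hj, ?_⟩
  have hk : (-8 : ℝ) < 2 * k ∧ 2 * (k : ℝ) < 8 := by
    rcases hi with hi | hi <;> rcases hj with hj | hj <;> rw [hi, hj] at kz <;>
      constructor <;> linarith
  have hk1 : (-8 : ℤ) < 2 * k := by exact_mod_cast hk.1
  have hk2 : 2 * k < (8 : ℤ) := by exact_mod_cast hk.2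
  have h1 : (-3 : ℝ) ≤ k := by exact_mod_cast (by omega : (-3 : ℤ) ≤ k)
  have h2 : (k : ℝ) ≤ 3 := by exact_mod_cast (by omega : k ≤ (3 : ℤ))
  exact abs_le.2 ⟨by simp only [latticeMk]; linarith, by simp only [latticeMk]; linarith⟩

/-- The rescaled point tends to e, so the index is nearly the inverse of a point of `tileHull`. All
coordinates there have absolute value below 2, and the only lattice point close to such an inverse
is e. -/
theorem eventually_iterate_cell_eq_one (ξ : lattice) : ∃ N : ℕ, ∀ n ≥ N, cell^[n] ξ = 1 := by
  have lim : ∀ c : ℝ, ∀ᶠ n : ℕ in Filter.atTop, |(1 / 4 : ℝ) ^ n * c| < 1 / 10 := by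
    intro c
    have h : Filter.Tendsto (fun n : ℕ => |(1 / 4 : ℝ) ^ n * c|) Filter.atTop (nhds 0) := by
      have := (tendsto_pow_atTop_nhds_zero_of_lt_one (r := (1 / 4 : ℝ)) (by norm_num)
        (by norm_num)).mul_const c
      simpa using this.abs
    exact h.eventually_lt_const (by norm_num)
  obtain ⟨N, hN⟩ := Filter.eventually_atTop.1
    ((lim ξ.1.x).and ((lim ξ.1.y).and (lim ξ.1.z)))
  refine ⟨N, fun n hn => ?_⟩
  obtain ⟨vx, vy, vz⟩ := hN n hn
  set w : lattice := cell^[n] ξ with hw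
  set h : Heis := (w : Heis)⁻¹ * dil ((1 / 4) ^ n) ξ with hh
  have hA : h ∈ tileHull := iterate_cell_inv_mul_dil_mem n ξ
  have key : (w : Heis) * h = dil ((1 / 4) ^ n) ξ := by rw [hh, mul_inv_cancel_left]
  have kx := congrArg Heis.x key
  have ky := congrArg Heis.y key
  have kz := congrArg Heis.z key
  simp only [mul_x, mul_y, mul_z, dil_x, dil_y, dil_z] at kx ky kz
  obtain ⟨⟨hx1, hx2⟩, ⟨hy1, hy2⟩, hz⟩ := hA
  have hs1 : (1 / 4 : ℝ) ^ n ≤ 1 := pow_le_one₀ (by norm_num) (by norm_num)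
  have hz' : |((1 / 4 : ℝ) ^ n) ^ 2 * ξ.1.z| < 1 / 10 := by
    rw [pow_two, mul_assoc, abs_mul, abs_of_nonneg (by positivity : (0 : ℝ) ≤ (1 / 4) ^ n)]
    exact lt_of_le_of_lt (mul_le_of_le_one_left (abs_nonneg _) hs1) vz
  rw [abs_lt] at vx vy hz'
  rw [abs_le] at hz
  have even : ∀ i : ℤ, (-2 : ℝ) < 2 * i → 2 * (i : ℝ) < 2 → i = 0 := by
    intro i h1 h2
    have h1' : (-2 : ℤ) < 2 * i := by exact_mod_cast h1
    have h2' : 2 * i < (2 : ℤ) := by exact_mod_cast h2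
    omega
  obtain ⟨i, j, k, hijk⟩ := latticeMk_surjective w
  rw [hijk] at kx ky kz ⊢
  simp only [latticeMk] at kx ky kz
  have hi := even i (by linarith) (by linarith)
  have hj := even j (by linarith) (by linarith)
  subst hi hj
  simp only [Int.cast_zero, mul_zero, zero_mul, sub_zero, add_zero] at kz
  have hk := even k (by linarith) (by linarith)
  subst hk
  exact latticeMk_one

theorem eventually_iterate_cell_eq_one_of_finite {F : Set lattice} (hF : F.Finite) :
    ∃ N : ℕ, ∀ n ≥ N, ∀ ξ ∈ F, cell^[n] ξ = 1 := by
  have : ∀ᶠ n : ℕ in Filter.atTop, ∀ ξ ∈ F, cell^[n] ξ = 1 :=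
    (Filter.eventually_all_finite hF).2 fun ξ _ =>
      Filter.eventually_atTop.2 (eventually_iterate_cell_eq_one ξ)
  exact Filter.eventually_atTop.1 this

/-- Two points in the same `n`-th order supertile are at distance less than `4 * 4 ^ n`. -/
theorem inv_mul_mem_ballOne {n : ℕ} {ξ ζ : lattice} (h : cell^[n] ξ = cell^[n] ζ) {R : ℝ}
    (hR : 4 * 4 ^ n ≤ R) : ξ⁻¹ * ζ ∈ ballOne latticeDist R := by
  set g : Heis := ((cell^[n] ξ : lattice) : Heis)⁻¹ * dil ((1 / 4) ^ n) ξ with hg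
  set k : Heis := ((cell^[n] ξ : lattice) : Heis)⁻¹ * dil ((1 / 4) ^ n) ζ with hk
  have hgA : g ∈ tileHull := iterate_cell_inv_mul_dil_mem n ξ
  have hkA : k ∈ tileHull := by rw [hk, h]; exact iterate_cell_inv_mul_dil_mem n ζ
  have key : dil ((1 / 4) ^ n) (ξ⁻¹ * ζ : lattice) = g⁻¹ * k := by
    have : ((ξ⁻¹ * ζ : lattice) : Heis) = (ξ : Heis)⁻¹ * ζ := rfl
    rw [hg, hk, this, map_mul, map_inv]
    group
  set u : lattice := ξ⁻¹ * ζ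
  have kx := congrArg Heis.x key
  have ky := congrArg Heis.y key
  have kz := congrArg Heis.z key
  simp only [mul_x, mul_y, mul_z, inv_x, inv_y, inv_z, dil_x, dil_y, dil_z] at kx ky kz
  obtain ⟨⟨gx1, gx2⟩, ⟨gy1, gy2⟩, gz⟩ := hgA
  obtain ⟨⟨kx1, kx2⟩, ⟨ky1, ky2⟩, kz'⟩ := hkA
  have b1 := abs_le.1 (abs_mul_le_mul_of_le (a := -g.x) (b := k.y) (s := 4 / 3) (t := 4 / 3)
    (abs_le.2 ⟨by linarith, by linarith⟩) (abs_le.2 ⟨by linarith, by linarith⟩))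
  have b2 := abs_le.1 (abs_mul_le_mul_of_le (a := k.x) (b := -g.y) (s := 4 / 3) (t := 4 / 3)
    (abs_le.2 ⟨by linarith, by linarith⟩) (abs_le.2 ⟨by linarith, by linarith⟩))
  rw [abs_le] at gz kz'
  have hp : (0 : ℝ) < 4 ^ n := by positivity
  have hinv : (4 : ℝ) ^ n * (1 / 4) ^ n = 1 := by rw [← mul_pow]; norm_num
  have hR0 : 0 ≤ R := le_trans (by positivity) hR
  have bx : ((1 / 4 : ℝ) ^ n * u.1.x) ^ 2 ≤ 2 ^ 2 := sq_le_sq.2 (by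
    rw [abs_two]; exact abs_le.2 ⟨by linarith, by linarith⟩)
  have by' : ((1 / 4 : ℝ) ^ n * u.1.y) ^ 2 ≤ 2 ^ 2 := sq_le_sq.2 (by
    rw [abs_two]; exact abs_le.2 ⟨by linarith, by linarith⟩)
  have bz : (((1 / 4 : ℝ) ^ n) ^ 2 * u.1.z) ^ 2 ≤ 5 ^ 2 := sq_le_sq.2 (by
    rw [abs_of_pos (by norm_num : (0 : ℝ) < 5)]
    exact abs_le.2 ⟨by linarith, by linarith⟩)
  -- Rescaled by 4⁻ⁿ, the difference has |x|, |y| ≤ 2 and |z| ≤ 5, and (2² + 2²)² + 5² = 89 < 4⁴.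
  rw [mem_ballOne_iff]
  refine ⟨hR0, ?_⟩
  calc (u.1.x ^ 2 + u.1.y ^ 2) ^ 2 + u.1.z ^ 2
      = (((1 / 4 : ℝ) ^ n * u.1.x) ^ 2 + ((1 / 4 : ℝ) ^ n * u.1.y) ^ 2) ^ 2 * (4 ^ n) ^ 4
        + (((1 / 4 : ℝ) ^ n) ^ 2 * u.1.z) ^ 2 * (4 ^ n) ^ 4 := by
        have e : (1 / 4 : ℝ) ^ n = (4 ^ n)⁻¹ := by rw [one_div, inv_pow]
        rw [e]
        field_simp
    _ ≤ (2 ^ 2 + 2 ^ 2) ^ 2 * (4 ^ n) ^ 4 + 5 ^ 2 * (4 ^ n) ^ 4 := by gcongr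
    _ < (4 * 4 ^ n) ^ 4 := by nlinarith [pow_pos hp 4]
    _ ≤ R ^ 4 := by gcongr

/-! ### Level sets and the testing domain -/

/-- This translates the geometric level sets into supertiles; only this inclusion is needed for the
covering properties. -/
theorem mem_levelSet {M : Set Heis} {n : ℕ} {ξ : lattice}
    (h : ((cell^[n] ξ : lattice) : Heis) ∈ M) : (ξ : Heis) ∈ levelSet n M := by
  induction n generalizing ξ with
  | zero => exact Set.mem_mul.2 ⟨ξ, h, 1, by simp [domV], mul_one _⟩
  | succ n ih =>
    rw [Function.iterate_succ_apply] at h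
    obtain ⟨v, hv, e⟩ := (cellPos ξ).2
    refine ⟨(cell ξ : Heis) * v, Set.mul_mem_mul ⟨ih h, (cell ξ).2⟩ hv, ?_⟩
    rw [map_mul, e]
    exact congrArg Subtype.val (latticeD_cell_mul_cellPos ξ)

theorem core_subset_block : core ⊆ block := by
  rintro t ⟨hx, hy, hz⟩
  obtain ⟨i, j, k, rfl⟩ := latticeMk_surjective t
  simp only [latticeMk] at hx hy hz
  rw [abs_le] at hz
  have hx' : 2 * i = -2 ∨ 2 * i = 0 := by exact_mod_cast hx
  have hy' : 2 * j = -2 ∨ 2 * j = 0 := by exact_mod_cast hy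
  have h1 : (-6 : ℤ) ≤ 2 * k := by exact_mod_cast hz.1
  have h2 : 2 * k ≤ (6 : ℤ) := by exact_mod_cast hz.2
  exact latticeMk_mem_block.2 (by omega)

theorem coe_mem_levelSet_one {η : lattice} (h : η ∈ block) : (η : Heis) ∈ levelSet 1 {1} :=
  mem_levelSet (n := 1) (by
    rw [Function.iterate_one, cell_block ⟨η, h⟩]
    rfl)

theorem finite_block : block.Finite := by
  refine (finite_lattice_box 4 4 16).subset fun η hη => ?_
  obtain ⟨v, ⟨hx, hy, hz⟩, e⟩ := hη
  have ex := congrArg Heis.x e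
  have ey := congrArg Heis.y e
  have ez := congrArg Heis.z e
  simp only [D, dil_x, dil_y, dil_z] at ex ey ez
  exact ⟨abs_le.2 ⟨by linarith [hx.1], by linarith [hx.2]⟩,
    abs_le.2 ⟨by linarith [hy.1], by linarith [hy.2]⟩,
    abs_le.2 ⟨by linarith [hz.1], by linarith [hz.2]⟩⟩

theorem levelSet_one_inter_lattice : levelSet 1 {1} ∩ lattice = Subtype.val '' block := by
  ext g
  constructor
  · rintro ⟨⟨_, ⟨l, ⟨hl, hl'⟩, v, hv, rfl⟩, rfl⟩, hg⟩
    obtain ⟨_, rfl, w, hw, rfl⟩ := hl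
    have e : (⟨1 * w, hl'⟩ : lattice) = 1 := by
      refine (exists_unique_lattice w).unique (y₁ := ⟨1 * w, hl'⟩) (y₂ := 1) ?_ (by simpa using hw)
      simp [domV]
    have e' : (1 : Heis) * w = 1 := congrArg Subtype.val e
    exact ⟨⟨_, hg⟩, ⟨v, hv, by simp [e']⟩, rfl⟩
  · rintro ⟨η, hη, rfl⟩
    exact ⟨coe_mem_levelSet_one hη, η.2⟩

theorem exists_pow_four_ge (r : ℝ) : ∃ N : ℕ, ∀ n ≥ N, 10 * r ≤ 4 ^ n := by
  obtain ⟨N, hN⟩ := pow_unbounded_of_one_lt (10 * r) (by norm_num : (1 : ℝ) < 4)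
  exact ⟨N, fun n hn => hN.le.trans (pow_le_pow_right₀ (by norm_num) hn)⟩

theorem isTestingDomain_levelSet_one : IsTestingDomain (levelSet 1 {1} ∩ lattice) := by
  have cover : ∀ r : ℝ, ∀ n : ℕ, 10 * r ≤ 4 ^ n → ∀ x ∈ lattice, ∃ γ ∈ lattice,
      x • (Subtype.val '' ballOne latticeDist r) ⊆
        (D^[n] γ) • levelSet n (levelSet 1 {1} ∩ lattice) := by
    intro r n hn x hx
    obtain ⟨γ, hγ⟩ := exists_iterate_cell_mem_core n ⟨x, hx⟩ hn
    refine ⟨γ, γ.2, ?_⟩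
    rintro _ ⟨_, ⟨u, hu, rfl⟩, rfl⟩
    have hm : cell^[n] ((latticeD^[n] γ)⁻¹ * (⟨x, hx⟩ * u)) ∈ core := by
      rw [← iterate_latticeD_inv, iterate_cell_mul]
      exact hγ u hu
    refine ⟨((latticeD^[n] γ)⁻¹ * (⟨x, hx⟩ * u) : lattice), mem_levelSet
      ⟨coe_mem_levelSet_one (core_subset_block hm), Subtype.property _⟩, ?_⟩
    simp [← coe_iterate_latticeD]
  have hfin : (levelSet 1 {1} ∩ lattice : Set Heis).Finite := by
    rw [levelSet_one_inter_lattice]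
    exact finite_block.image _
  have hne : {m : ℕ | 1 ≤ m ∧ ∀ x ∈ lattice, ∃ γ ∈ lattice,
      x • (levelSet 1 {1} ∩ lattice : Set Heis) ⊆
        (D^[m] γ) • levelSet m (levelSet 1 {1} ∩ lattice)}.Nonempty := by
    -- Points of T have |x|, |y| ≤ 4 and |z| ≤ 16, so T lies in the ball of radius 8 because 32² +
    -- 16² < 8⁴. The level N + 1 is taken so that m ≥ 1.
    obtain ⟨N, hN⟩ := exists_pow_four_ge 8
    refine ⟨N + 1, by omega, fun x hx => ?_⟩
    obtain ⟨γ, hγ, h⟩ := cover 8 (N + 1) (hN _ (by omega)) x hx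
    refine ⟨γ, hγ, (Set.smul_set_mono ?_).trans h⟩
    rw [levelSet_one_inter_lattice]
    refine Set.image_mono fun η hη => ?_
    obtain ⟨v, ⟨vx, vy, vz⟩, e⟩ := hη
    have ex := congrArg Heis.x e
    have ey := congrArg Heis.y e
    have ez := congrArg Heis.z e
    simp only [D, dil_x, dil_y, dil_z] at ex ey ez
    have hx2 : η.1.x ^ 2 ≤ 4 ^ 2 := sq_le_sq' (by linarith [vx.1]) (by linarith [vx.2])
    have hy2 : η.1.y ^ 2 ≤ 4 ^ 2 := sq_le_sq' (by linarith [vy.1]) (by linarith [vy.2])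
    have hz2 : η.1.z ^ 2 ≤ 16 ^ 2 := sq_le_sq' (by linarith [vz.1]) (by linarith [vz.2])
    have hxy : (η.1.x ^ 2 + η.1.y ^ 2) ^ 2 ≤ 32 ^ 2 :=
      pow_le_pow_left₀ (by positivity) (by linarith) 2
    exact mem_ballOne_iff.2 ⟨by norm_num, by linarith⟩
  refine ⟨sInf _, Set.inter_subset_right, hfin, fun r _ => ?_, Nat.sInf_mem hne,
    fun m hm => Nat.sInf_le hm⟩
  obtain ⟨N, hN⟩ := exists_pow_four_ge r
  exact ⟨N, fun n hn => cover r n (hN n hn)⟩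

end Heis

/-! ### Configurations and their distances -/

section Configurations

variable {Γ A : Type*}

theorem mem_closure_config [TopologicalSpace A] [DiscreteTopology A] {X : Set (Γ → A)}
    {ω : Γ → A} :
    ω ∈ closure X ↔ ∀ F : Set Γ, F.Finite → ∃ ρ ∈ X, ∀ γ ∈ F, ω γ = ρ γ := by
  constructor
  · intro h F hF
    have ho : IsOpen (F.pi fun γ => ({ω γ} : Set A)) :=
      isOpen_set_pi hF fun _ _ => isOpen_discrete _
    obtain ⟨ρ, hρ, hρX⟩ := mem_closure_iff.1 h _ ho fun _ _ => rfl
    exact ⟨ρ, hρX, fun γ hγ => (hρ γ hγ).symm⟩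
  · intro h
    refine mem_closure_iff.2 fun U hU hω => ?_
    obtain ⟨I, u, hu, hsub⟩ := isOpen_pi_iff.1 hU ω hω
    obtain ⟨ρ, hρX, hρ⟩ := h I I.finite_toSet
    exact ⟨ρ, hsub fun γ hγ => hρ γ hγ ▸ (hu γ hγ).2, hρX⟩

variable [Group Γ] {d : Γ → Γ → ℝ}

theorem shift_shift (γ η : Γ) (ω : Γ → A) : shift γ (shift η ω) = shift (γ * η) ω := by
  funext ξ
  simp [shift, mul_assoc]

theorem configDist_nonneg (ω ρ : Γ → A) : 0 ≤ configDist d ω ρ := by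
  refine Real.sInf_nonneg ?_
  rintro _ ⟨r, hr, -, rfl⟩
  positivity

theorem configDist_le {ω ρ : Γ → A} {r : ℝ} (hr : 0 ≤ r) (h : ∀ γ ∈ ballOne d r, ω γ = ρ γ) :
    configDist d ω ρ ≤ 1 / (r + 1) := by
  refine csInf_le ⟨0, ?_⟩ ⟨r, hr, h, rfl⟩
  rintro _ ⟨r, hr, -, rfl⟩
  positivity

theorem configHausdorffDist_nonneg (Ω₁ Ω₂ : Set (Γ → A)) : 0 ≤ configHausdorffDist d Ω₁ Ω₂ :=
  le_max_of_le_left (Real.iSup_nonneg fun _ => Real.iInf_nonneg fun _ => configDist_nonneg _ _)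

theorem configHausdorffDist_le {Ω₁ Ω₂ : Set (Γ → A)} {r : ℝ} (hr : 0 ≤ r)
    (h₁ : ∀ ω ∈ Ω₁, ∃ ρ ∈ Ω₂, ∀ γ ∈ ballOne d r, ω γ = ρ γ)
    (h₂ : ∀ ρ ∈ Ω₂, ∃ ω ∈ Ω₁, ∀ γ ∈ ballOne d r, ω γ = ρ γ) :
    configHausdorffDist d Ω₁ Ω₂ ≤ 1 / (r + 1) := by
  have hpos : 0 ≤ 1 / (r + 1) := by positivity
  refine max_le (Real.iSup_le (fun ω => ?_) hpos) (Real.iSup_le (fun ρ => ?_) hpos)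
  · obtain ⟨ρ, hρ, h⟩ := h₁ ω.1 ω.2
    refine (ciInf_le ⟨0, ?_⟩ (⟨ρ, hρ⟩ : Ω₂)).trans (configDist_le hr h)
    rintro _ ⟨_, rfl⟩
    exact configDist_nonneg _ _
  · obtain ⟨ω, hω, h⟩ := h₂ ρ.1 ρ.2
    refine (ciInf_le ⟨0, ?_⟩ (⟨ω, hω⟩ : Ω₁)).trans (configDist_le hr h)
    rintro _ ⟨_, rfl⟩
    exact configDist_nonneg _ _

end Configurations

namespace Heis

/-! ### Iterated substitutions -/

section Substitution

variable {A : Type*} (S₀ : A → block → A)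

theorem substConfig_apply (ω : lattice → A) (γ : lattice) (η : block) :
    substConfig S₀ ω (latticeD γ * η) = S₀ (ω γ) η := by
  simp [substConfig, cell_mul, cellPos_mul]

theorem iterate_substConfig_mul (n : ℕ) (ω : lattice → A) (γ ξ : lattice) :
    (substConfig S₀)^[n] ω (latticeD^[n] γ * ξ) =
      (substConfig S₀)^[n] (fun η => ω (γ * η)) ξ := by
  induction n generalizing ω γ with
  | zero => rfl
  | succ n ih =>
    rw [Function.iterate_succ_apply, Function.iterate_succ_apply, Function.iterate_succ_apply, ih]
    have e : (fun η => substConfig S₀ ω (latticeD γ * η)) =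
        substConfig S₀ fun η => ω (γ * η) := by
      funext η
      simp [substConfig, cell_latticeD_mul, cellPos_latticeD_mul]
    rw [e]

theorem iterate_substConfig_congr (n : ℕ) {ω ρ : lattice → A} {ξ : lattice}
    (h : ω (cell^[n] ξ) = ρ (cell^[n] ξ)) :
    (substConfig S₀)^[n] ω ξ = (substConfig S₀)^[n] ρ ξ := by
  induction n generalizing ω ρ with
  | zero => exact h
  | succ n ih =>
    rw [Function.iterate_succ_apply, Function.iterate_succ_apply]
    refine ih ?_
    rw [Function.iterate_succ_apply'] at h
    simp only [substConfig, h]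

/-- Equal letters at two points give equal letters at corresponding points of the `n`-th order
supertiles over them. -/
theorem iterate_substConfig_transfer (n : ℕ) {ω ρ : lattice → A} (δ : lattice) {ξ : lattice}
    (h : ω (cell^[n] ξ) = ρ (δ * cell^[n] ξ)) :
    (substConfig S₀)^[n] ω ξ = (substConfig S₀)^[n] ρ (latticeD^[n] δ * ξ) := by
  rw [iterate_substConfig_mul]
  exact iterate_substConfig_congr S₀ n h

open Classical in
theorem iterate_substPatch_letterPatch (n : ℕ) (c : A) (ξ : lattice) :
    (substPatch S₀)^[n] (letterPatch c) ξ =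
      if cell^[n] ξ = 1 then some ((substConfig S₀)^[n] (fun _ => c) ξ) else none := by
  induction n generalizing ξ with
  | zero => rfl
  | succ n ih =>
    rw [Function.iterate_succ_apply' (substPatch S₀), substPatch, ih,
      Function.iterate_succ_apply cell, Function.iterate_succ_apply' (substConfig S₀)]
    by_cases h : cell^[n] (cell ξ) = 1 <;> simp [h, substConfig]

theorem mem_legalPatches {P : Patch lattice A} (hP : (patchSupport P).Finite) :
    P ∈ legalPatches S₀ ↔ ∃ (n : ℕ) (c : A) (γ : lattice), 1 ≤ n ∧ ∀ η ∈ patchSupport P,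
      cell^[n] (γ * η) = 1 ∧ P η = some ((substConfig S₀)^[n] (fun _ => c) (γ * η)) := by
  constructor
  · rintro ⟨-, n, c, hn, γ, h⟩
    refine ⟨n, c, γ, hn, fun η hη => ?_⟩
    have := h η hη
    rw [iterate_substPatch_letterPatch] at this
    split_ifs at this with h1
    · exact ⟨h1, this.symm⟩
    · exact absurd this.symm hη
  · rintro ⟨n, c, γ, hn, h⟩
    refine ⟨hP, n, c, hn, γ, fun η hη => ?_⟩
    rw [iterate_substPatch_letterPatch, if_pos (h η hη).1, (h η hη).2]

theorem mem_substSubshift {ω : lattice → A} :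
    ω ∈ substSubshift S₀ ↔ ∀ F : Set lattice, F.Finite →
      ∃ (n : ℕ) (c : A) (γ : lattice), 1 ≤ n ∧ ∀ η ∈ F,
        cell^[n] (γ * η) = 1 ∧ ω η = (substConfig S₀)^[n] (fun _ => c) (γ * η) := by
  classical
  constructor
  · intro h F hF
    set P : Patch lattice A := fun η => if η ∈ F then some (ω η) else none with hP
    have hs : patchSupport P = F := by
      ext η
      by_cases hη : η ∈ F <;> simp [patchSupport, hP, hη]
    have hPω : P ∈ dictionary {ω} := by
      refine ⟨hs ▸ hF, ω, rfl, 1, fun η hη => ?_⟩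
      rw [hs] at hη
      simp [hP, hη, configPatch]
    obtain ⟨n, c, γ, hn, hγ⟩ := (mem_legalPatches S₀ (hs ▸ hF)).1 (h hPω)
    refine ⟨n, c, γ, hn, fun η hη => ?_⟩
    have := hγ η (hs ▸ hη)
    refine ⟨this.1, Option.some.inj ?_⟩
    rw [← this.2, hP]
    simp [hη]
  · rintro h P ⟨hP, _, rfl, δ, hδ⟩
    obtain ⟨n, c, γ, hn, hγ⟩ := h ((δ * ·) '' patchSupport P) (hP.image _)
    refine (mem_legalPatches S₀ hP).2 ⟨n, c, γ * δ, hn, fun η hη => ?_⟩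
    have := hγ (δ * η) ⟨η, hη, rfl⟩
    rw [mul_assoc]
    exact ⟨this.1, by rw [← hδ η hη, ← this.2]; rfl⟩

theorem continuous_iterate_substConfig [TopologicalSpace A] [DiscreteTopology A] (n : ℕ) :
    Continuous (substConfig S₀)^[n] := by
  refine Continuous.iterate (continuous_pi fun ξ => ?_) n
  exact (continuous_of_discreteTopology (f := fun c : A => S₀ c (cellPos ξ))).comp
    (continuous_apply (cell ξ))

theorem finite_iterate_cell_eq_one (n : ℕ) : {ξ : lattice | cell^[n] ξ = 1}.Finite := by
  refine (finite_ballOne (4 * 4 ^ n)).subset fun ξ hξ => ?_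
  have := inv_mul_mem_ballOne (n := n) (ξ := 1) (ζ := ξ)
    (by rw [iterate_cell_one]; exact hξ.symm) le_rfl
  simpa using this

/-- Every translate of a configuration `Sⁿ(ω)` is a translate of some `Sⁿ(ρ)` by one of finitely
many elements. -/
theorem exists_shift_iterate_substConfig (n : ℕ) (ω : lattice → A) (γ : lattice) :
    ∃ δ : lattice, cell^[n] δ = 1 ∧ shift γ ((substConfig S₀)^[n] ω) =
      shift δ⁻¹ ((substConfig S₀)^[n] fun η => ω (cell^[n] γ⁻¹ * η)) := by
  -- Split γ⁻¹ as Dⁿ of its supertile index times a position δ in the supertile at e; the first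
  -- factor passes through Sⁿ.
  refine ⟨(latticeD^[n] (cell^[n] γ⁻¹))⁻¹ * γ⁻¹, ?_, ?_⟩
  · rw [← iterate_latticeD_inv, iterate_cell_mul, inv_mul_cancel]
  · funext ξ
    simp only [shift, inv_inv]
    rw [← iterate_substConfig_mul, mul_assoc, mul_inv_cancel_left]

/-- A constant configuration absorbs the Dⁿ(Γ) part of a translation, so only the finitely many
positions in the supertile at e matter. -/
theorem isPeriodicConfig_iterate_substConfig (n : ℕ) (c : A) :
    IsPeriodicConfig ((substConfig S₀)^[n] fun _ => c) := by
  refine ((finite_iterate_cell_eq_one n).image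
    fun δ => shift δ⁻¹ ((substConfig S₀)^[n] fun _ => c)).subset ?_
  rintro _ ⟨γ, rfl⟩
  obtain ⟨δ, hδ, e⟩ := exists_shift_iterate_substConfig S₀ n (fun _ => c) γ
  exact ⟨δ, hδ, e.symm⟩

/-- The translates of the configurations in the image of `Sⁿ`. -/
def substImage (n : ℕ) : Set (lattice → A) :=
  {ω | ∃ (γ : lattice) (ρ : lattice → A), ω = shift γ ((substConfig S₀)^[n] ρ)}

/-- Finitely many translations δ suffice, so the set is a finite union of continuous images of the
compact space of all configurations. -/
theorem isClosed_substImage [TopologicalSpace A] [DiscreteTopology A] [Finite A] (n : ℕ) :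
    IsClosed (substImage S₀ n) := by
  have e : substImage S₀ n = ⋃ δ ∈ {δ : lattice | cell^[n] δ = 1},
      Set.range fun ρ : lattice → A => shift δ⁻¹ ((substConfig S₀)^[n] ρ) := by
    ext ω
    simp only [Set.mem_iUnion]
    constructor
    · rintro ⟨γ, ρ, rfl⟩
      obtain ⟨δ, hδ, e⟩ := exists_shift_iterate_substConfig S₀ n ρ γ
      exact ⟨δ, hδ, _, e.symm⟩
    · rintro ⟨δ, -, ρ, rfl⟩
      exact ⟨_, ρ, rfl⟩
  rw [e]
  refine (finite_iterate_cell_eq_one n).isClosed_biUnion fun δ _ => ?_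
  refine (isCompact_range ?_).isClosed
  exact (continuous_pi fun ξ => continuous_apply _).comp (continuous_iterate_substConfig S₀ n)

end Substitution

end Heis
namespace Heis

/-! ### Recognizability -/

section Rule

variable {S₀ : Letter → block → Letter}

theorem substConfig_blockMk (ω : lattice → Letter) (p q r : ℤ) {s t w i j k : ℤ}
    (h : (-2 ≤ s ∧ s ≤ 1) ∧ (-2 ≤ t ∧ t ≤ 1) ∧ -8 ≤ w ∧ w ≤ 7)
    (hi : i = 4 * p + s) (hj : j = 4 * q + t) (hk : k = 16 * r + w + (4 * p * t - s * (4 * q))) :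
    substConfig S₀ ω (latticeMk i j k) = S₀ (ω (latticeMk p q r)) (blockMk s t w h) := by
  rw [← substConfig_apply S₀ ω, latticeD_mk, blockMk, latticeMk_mul, hi, hj, hk]

theorem apply_marker (hS₀ : IsHeisRule S₀) (c : Letter) :
    S₀ c (blockMk 1 1 (-8) (by norm_num)) = c :=
  hS₀.marker c _ (by simp only [blockMk, latticeMk]; norm_num)

/-- A position of the block at which every image of a letter carries the given letter. -/
def letterPos : Letter → block
  | .a => blockMk 0 0 0 (by norm_num)
  | .b => blockMk 1 1 (-7) (by norm_num)

theorem apply_letterPos (hS₀ : IsHeisRule S₀) (c c' : Letter) : S₀ c' (letterPos c) = c := by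
  cases c
  · exact hS₀.axis _ _ (by simp [letterPos, blockMk, latticeMk])
      (by simp [letterPos, blockMk, latticeMk])
  · exact hS₀.next_marker _ _ (by simp only [letterPos, blockMk, latticeMk]; norm_num)

theorem substConfig_one (hS₀ : IsHeisRule S₀) (ω : lattice → Letter) :
    substConfig S₀ ω 1 = Letter.a := by
  rw [← latticeMk_one, substConfig_blockMk _ 0 0 0 (s := 0) (t := 0) (w := 0) (by norm_num)
    (by ring) (by ring) (by ring)]
  exact apply_letterPos hS₀ Letter.a _

/-- The all-`a` central axis detects the horizontal residue of δ modulo 4, the line over (0, 2)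
detects the vertical residue modulo 16, and the marker recovers the preimages. -/
theorem exists_latticeD_eq_of_substConfig_mul (hS₀ : IsHeisRule S₀) {ω ρ : lattice → Letter}
    {δ : lattice} (h : ∀ ξ, substConfig S₀ ω (δ * ξ) = substConfig S₀ ρ ξ) :
    ∃ δ' : lattice, δ = latticeD δ' ∧ ∀ ξ, ω (δ' * ξ) = ρ ξ := by
  obtain ⟨d, e, f, rfl⟩ := latticeMk_surjective δ
  have hp : ∃ p s : ℤ, d = 4 * p + s ∧ -2 ≤ s ∧ s ≤ 1 :=
    ⟨(d + 2) / 4, d - 4 * ((d + 2) / 4), by omega, by omega, by omega⟩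
  have hq : ∃ q t : ℤ, e = 4 * q + t ∧ -2 ≤ t ∧ t ≤ 1 :=
    ⟨(e + 2) / 4, e - 4 * ((e + 2) / 4), by omega, by omega, by omega⟩
  obtain ⟨p, s, rfl, hs⟩ := hp
  obtain ⟨q, t, rfl, ht⟩ := hq
  -- Otherwise δ carries a vertical line that is constantly `a` onto a line over (s, t) ≠ (0, 0),
  -- which meets the layer of `b`'s; k is the height at which this happens.
  have hst : s = 0 ∧ t = 0 := by
    by_contra hne
    set k : ℤ := -1 + (4 * p * t - s * (4 * q)) - f with hk
    have h1 := h (latticeMk 0 0 k)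
    have hr : ∃ r w : ℤ, k = 16 * r + w ∧ -8 ≤ w ∧ w ≤ 7 :=
      ⟨(k + 8) / 16, k - 16 * ((k + 8) / 16), by omega, by omega, by omega⟩
    obtain ⟨r, w, hkw, hw⟩ := hr
    rw [latticeMk_mul,
      substConfig_blockMk ω p q 0 (s := s) (t := t) (w := -1) ⟨hs, ht, by norm_num⟩
        (by ring) (by ring) (by rw [hk]; ring),
      substConfig_blockMk ρ 0 0 r (s := 0) (t := 0) (w := w) ⟨by norm_num, by norm_num, hw⟩
        (by ring) (by ring) (by rw [hkw]; ring),
      hS₀.axis _ (blockMk 0 0 w _) (by simp [blockMk, latticeMk]) (by simp [blockMk, latticeMk]),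
      hS₀.layer _ (blockMk s t (-1) _) (by simp only [blockMk, latticeMk]; norm_num)
        (by simpa [blockMk, latticeMk] using hne)] at h1
    cases h1
  obtain ⟨rfl, rfl⟩ := hst
  have hf : ∃ r w : ℤ, f - 1 = 16 * r + w ∧ -8 ≤ w ∧ w ≤ 7 :=
    ⟨(f - 1 + 8) / 16, f - 1 - 16 * ((f - 1 + 8) / 16), by omega, by omega, by omega⟩
  obtain ⟨r, w, hfw, hw⟩ := hf
  -- In half coordinates the layer z = -2 is -1. The letter `b` at (0, 1, -1) would be moved to
  -- another height of the same line, where every letter is `a`.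
  have hw1 : w = -1 := by
    by_contra hne
    have h1 := h (latticeMk 0 1 (-1))
    rw [latticeMk_mul,
      substConfig_blockMk ω p q r (s := 0) (t := 1) (w := w) ⟨by norm_num, by norm_num, hw⟩
        (by ring) (by ring) (by linear_combination hfw),
      substConfig_blockMk ρ 0 0 0 (s := 0) (t := 1) (w := -1) (by norm_num)
        (by ring) (by ring) (by ring),
      hS₀.line _ (blockMk 0 1 w _) (by simp [blockMk, latticeMk]) (by simp [blockMk, latticeMk])
        (by
          simp only [blockMk, latticeMk]
          intro hz
          exact hne (by exact_mod_cast (by linarith : (w : ℝ) = -1))),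
      hS₀.layer _ (blockMk 0 1 (-1) _) (by simp only [blockMk, latticeMk]; norm_num)
        (by simp [blockMk, latticeMk])] at h1
    cases h1
  have hδ : latticeMk (4 * p + 0) (4 * q + 0) f = latticeD (latticeMk p q r) := by
    rw [latticeD_mk, latticeMk_eq_iff]
    omega
  refine ⟨_, hδ, fun ξ => ?_⟩
  have h1 := h (latticeD ξ * blockMk 1 1 (-8) (by norm_num))
  rwa [hδ, ← mul_assoc, ← latticeD_mul, substConfig_apply, substConfig_apply,
    apply_marker hS₀, apply_marker hS₀] at h1

theorem exists_iterate_latticeD_eq (hS₀ : IsHeisRule S₀) (n : ℕ) {ω ρ : lattice → Letter}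
    {δ : lattice} (h : ∀ ξ, (substConfig S₀)^[n] ω (δ * ξ) = (substConfig S₀)^[n] ρ ξ) :
    ∃ δ' : lattice, δ = latticeD^[n] δ' := by
  -- The relation between the preimages is what lets the induction descend one more level.
  suffices ∃ δ' : lattice, δ = latticeD^[n] δ' ∧ ∀ ξ, ω (δ' * ξ) = ρ ξ from
    this.imp fun _ h => h.1
  induction n generalizing δ with
  | zero => exact ⟨δ, rfl, h⟩
  | succ n ih =>
    simp only [Function.iterate_succ_apply'] at h
    obtain ⟨δ₁, rfl, h₁⟩ := exists_latticeD_eq_of_substConfig_mul hS₀ h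
    obtain ⟨δ₂, rfl, h₂⟩ := ih h₁
    exact ⟨δ₂, (Function.iterate_succ_apply' _ _ _).symm, h₂⟩

theorem eq_zero_of_forall_pow_dvd {m i : ℤ} (hm : 1 < m) (h : ∀ n : ℕ, m ^ n ∣ i) : i = 0 := by
  by_contra hi
  obtain ⟨n, hn⟩ := pow_unbounded_of_one_lt |i| hm
  exact absurd (Int.le_of_dvd (abs_pos.2 hi) ((dvd_abs _ _).2 (h n))) (not_le.2 hn)

/-- For each n a period is conjugate into Dⁿ(Γ), by a conjugator depending on n. Conjugation
preserves x and y, so both are divisible by every 4ⁿ and vanish. The period is then central, so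
conjugation fixes z too, and z is divisible by every 16ⁿ. -/
theorem stab_eq_of_forall_mem_substImage (hS₀ : IsHeisRule S₀) {ω : lattice → Letter}
    (hω : ∀ n, ω ∈ substImage S₀ n) : stab ω = {1} := by
  refine Set.eq_singleton_iff_unique_mem.2 ⟨by funext ξ; simp [shift], fun δ hδ => ?_⟩
  obtain ⟨i, j, k, rfl⟩ := latticeMk_surjective δ
  have key : ∀ n : ℕ, ∃ x y z p q r : ℤ, latticeMk i j k * latticeMk x y z =
      latticeMk x y z * latticeMk (4 ^ n * p) (4 ^ n * q) (16 ^ n * r) := by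
    intro n
    obtain ⟨γ, ρ, rfl⟩ := hω n
    obtain ⟨x, y, z, rfl⟩ := latticeMk_surjective γ
    obtain ⟨δ', h⟩ := exists_iterate_latticeD_eq hS₀ n (ω := ρ) (ρ := ρ)
      (δ := (latticeMk x y z)⁻¹ * latticeMk i j k * latticeMk x y z) fun ξ => by
        have := congrFun hδ (latticeMk i j k * latticeMk x y z * ξ)
        simpa [shift, mul_assoc] using this.symm
    obtain ⟨p, q, r, rfl⟩ := latticeMk_surjective δ'
    refine ⟨x, y, z, p, q, r, ?_⟩
    rw [← iterate_latticeD_mk, ← h]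
    group
  simp only [latticeMk_mul, latticeMk_eq_iff] at key
  have hi : i = 0 := eq_zero_of_forall_pow_dvd (m := 4) (by norm_num) fun n => by
    obtain ⟨x, y, z, p, q, r, h1, h2, h3⟩ := key n
    exact ⟨p, by linarith⟩
  have hj : j = 0 := eq_zero_of_forall_pow_dvd (m := 4) (by norm_num) fun n => by
    obtain ⟨x, y, z, p, q, r, h1, h2, h3⟩ := key n
    exact ⟨q, by linarith⟩
  subst hi hj
  have hk : k = 0 := eq_zero_of_forall_pow_dvd (m := 16) (by norm_num) fun n => by
    obtain ⟨x, y, z, p, q, r, h1, h2, h3⟩ := key n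
    have e1 : (4 : ℤ) ^ n * p = 0 := by linarith
    have e2 : (4 : ℤ) ^ n * q = 0 := by linarith
    rw [e1, e2] at h3
    exact ⟨r, by linarith⟩
  subst hk
  exact latticeMk_one

/-! ### The fixed point -/

/-- A configuration fixed by the substitution that carries `a` at the origin. -/
theorem exists_substConfig_fixed (hS₀ : IsHeisRule S₀) :
    ∃ ω₀ : lattice → Letter, substConfig S₀ ω₀ = ω₀ ∧ ∀ (n : ℕ) (ξ : lattice), cell^[n] ξ = 1 →
      ω₀ ξ = (substConfig S₀)^[n] (fun _ => Letter.a) ξ := by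
  set W : ℕ → lattice → Letter := fun n => (substConfig S₀)^[n] fun _ => Letter.a with hW
  -- On the supertile at e only the letter at e matters, and one substitution leaves an `a` there.
  have step : ∀ n ξ, cell^[n] ξ = 1 → W (n + 1) ξ = W n ξ := by
    intro n ξ hξ
    refine iterate_substConfig_congr S₀ n ?_
    rw [hξ, substConfig_one hS₀]
  have stable : ∀ n m ξ, cell^[n] ξ = 1 → W (n + m) ξ = W n ξ := by
    intro n m ξ hξ
    induction m with
    | zero => rfl
    | succ m ih =>
      rw [← add_assoc, step _ _ _, ih]
      rw [add_comm, Function.iterate_add_apply, hξ, iterate_cell_one]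
  choose N hN using eventually_iterate_cell_eq_one
  have spec : ∀ n ξ, cell^[n] ξ = 1 → W (N ξ) ξ = W n ξ := by
    intro n ξ hξ
    rw [← stable n (N ξ) ξ hξ, add_comm, stable _ _ _ (hN ξ _ le_rfl)]
  refine ⟨fun ξ => W (N ξ) ξ, ?_, spec⟩
  funext ξ
  have h := hN (cell ξ) _ le_rfl
  rw [spec (N (cell ξ) + 1) ξ (by rwa [Function.iterate_succ_apply])]
  simp only [hW, Function.iterate_succ_apply']
  rfl

end Rule

end Heis
namespace Heis

/-! ### The subshift as the orbit closure of the fixed point -/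

section FixedPoint

variable {S₀ : Letter → block → Letter} {ω₀ : lattice → Letter}

theorem fixed_letterPos (hS₀ : IsHeisRule S₀) (hfix : substConfig S₀ ω₀ = ω₀) (c : Letter) :
    ω₀ (letterPos c) = c := by
  have h := substConfig_apply S₀ ω₀ 1 (letterPos c)
  rwa [latticeD_one, one_mul, hfix, apply_letterPos hS₀] at h

/-- Both letters occur in ω₀ = Sⁿ(ω₀), so it contains every Sⁿ(c). Conversely, a finite piece of ω₀
lies in a large supertile at e, where ω₀ agrees with Sⁿ(a). -/
theorem mem_substSubshift_iff (hS₀ : IsHeisRule S₀) (hfix : substConfig S₀ ω₀ = ω₀)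
    (hlim : ∀ (n : ℕ) (ξ : lattice), cell^[n] ξ = 1 →
      ω₀ ξ = (substConfig S₀)^[n] (fun _ => Letter.a) ξ) {ω : lattice → Letter} :
    ω ∈ substSubshift S₀ ↔
      ∀ F : Set lattice, F.Finite → ∃ γ : lattice, ∀ η ∈ F, ω η = ω₀ (γ * η) := by
  rw [mem_substSubshift]
  refine forall₂_congr fun F hF => ⟨?_, ?_⟩
  · rintro ⟨n, c, γ, -, h⟩
    refine ⟨latticeD^[n] (letterPos c) * γ, fun η hη => ?_⟩
    obtain ⟨h1, h2⟩ := h η hη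
    rw [h2, iterate_substConfig_transfer S₀ n (ρ := ω₀) (letterPos c)
      (by rw [h1, mul_one, fixed_letterPos hS₀ hfix]), Function.iterate_fixed hfix, mul_assoc]
  · rintro ⟨γ, h⟩
    obtain ⟨N, hN⟩ := eventually_iterate_cell_eq_one_of_finite (hF.image (γ * ·))
    refine ⟨N + 1, Letter.a, γ, by omega, fun η hη => ?_⟩
    have h1 := hN (N + 1) (by omega) _ ⟨η, hη, rfl⟩
    exact ⟨h1, by rw [h η hη, hlim _ _ h1]⟩

theorem substSubshift_eq_closure_orb (hS₀ : IsHeisRule S₀) (hfix : substConfig S₀ ω₀ = ω₀)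
    (hlim : ∀ (n : ℕ) (ξ : lattice), cell^[n] ξ = 1 →
      ω₀ ξ = (substConfig S₀)^[n] (fun _ => Letter.a) ξ) :
    substSubshift S₀ = closure (orb ω₀) := by
  ext ω
  rw [mem_substSubshift_iff hS₀ hfix hlim, mem_closure_config]
  refine forall₂_congr fun F _ => ⟨?_, ?_⟩
  · rintro ⟨γ, h⟩
    exact ⟨_, ⟨γ⁻¹, rfl⟩, fun η hη => by simpa [shift] using h η hη⟩
  · rintro ⟨_, ⟨γ, rfl⟩, h⟩
    exact ⟨γ⁻¹, h⟩

theorem orb_subset_substImage (hfix : substConfig S₀ ω₀ = ω₀) (n : ℕ) :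
    orb ω₀ ⊆ substImage S₀ n := by
  rintro _ ⟨γ, rfl⟩
  exact ⟨γ, ω₀, by rw [Function.iterate_fixed hfix]⟩

theorem shift_mem_closure_orb {Γ A : Type*} [Group Γ] [TopologicalSpace A] {ω ρ : Γ → A} (γ : Γ)
    (h : ρ ∈ closure (orb ω)) : shift γ ρ ∈ closure (orb ω) := by
  have hc : Continuous (shift γ : (Γ → A) → Γ → A) := continuous_pi fun ξ => continuous_apply _
  refine map_mem_closure hc h ?_
  rintro _ ⟨η, rfl⟩
  exact ⟨γ * η, (shift_shift γ η ω).symm⟩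

/-! ### Repetitivity -/

/-- The prescribed boxes in S₀(a) and S₀(b) are exactly left translates of `core`, by (0, 0, 6) and
(-2, -2, 6); the tilt x - y in the second is the commutator term. -/
theorem exists_core_pattern_const (hS₀ : IsHeisRule S₀) (hfix : substConfig S₀ ω₀ = ω₀)
    (c : Letter) : ∃ γ : lattice, ∀ t ∈ core, ω₀ (γ * t) = c := by
  have key : ∃ s : lattice, ∀ t ∈ core, ∃ h : s * t ∈ block, S₀ c ⟨s * t, h⟩ = c := by
    have coord : ∀ t ∈ core, ∃ i j k : ℤ, t = latticeMk i j k ∧ (i = -1 ∨ i = 0) ∧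
        (j = -1 ∨ j = 0) ∧ -3 ≤ k ∧ k ≤ 3 := by
      rintro t ⟨hx, hy, hz⟩
      obtain ⟨i, j, k, rfl⟩ := latticeMk_surjective t
      simp only [latticeMk] at hx hy hz
      rw [abs_le] at hz
      have hx' : 2 * i = -2 ∨ 2 * i = 0 := by exact_mod_cast hx
      have hy' : 2 * j = -2 ∨ 2 * j = 0 := by exact_mod_cast hy
      have h1 : (-6 : ℤ) ≤ 2 * k := by exact_mod_cast hz.1
      have h2 : 2 * k ≤ (6 : ℤ) := by exact_mod_cast hz.2
      exact ⟨i, j, k, rfl, by omega, by omega, by omega, by omega⟩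
    cases c
    · refine ⟨latticeMk 0 0 3, fun t ht => ?_⟩
      obtain ⟨i, j, k, rfl, hi, hj, h1, h2⟩ := coord t ht
      have h1' : (-3 : ℝ) ≤ k := by exact_mod_cast h1
      have h2' : (k : ℝ) ≤ 3 := by exact_mod_cast h2
      rw [latticeMk_mul]
      refine ⟨latticeMk_mem_block.2 (by omega), hS₀.a_box _ ?_ ?_ ?_ ?_⟩
      · rcases hi with rfl | rfl <;> simp [latticeMk]
      · rcases hj with rfl | rfl <;> simp [latticeMk]
      · simp only [latticeMk]; push_cast; linarith
      · simp only [latticeMk]; push_cast; linarith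
    · refine ⟨latticeMk (-1) (-1) 3, fun t ht => ?_⟩
      obtain ⟨i, j, k, rfl, hi, hj, h1, h2⟩ := coord t ht
      have h1' : (-3 : ℝ) ≤ k := by exact_mod_cast h1
      have h2' : (k : ℝ) ≤ 3 := by exact_mod_cast h2
      rw [latticeMk_mul]
      refine ⟨latticeMk_mem_block.2 (by omega), hS₀.b_box _ ?_ ?_ (abs_le.2 ⟨?_, ?_⟩)⟩
      · rcases hi with rfl | rfl <;> simp only [latticeMk] <;> norm_num
      · rcases hj with rfl | rfl <;> simp only [latticeMk] <;> norm_num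
      · simp only [latticeMk]; push_cast; linarith
      · simp only [latticeMk]; push_cast; linarith
  obtain ⟨s, hs⟩ := key
  refine ⟨latticeD (letterPos c) * s, fun t ht => ?_⟩
  obtain ⟨h, e⟩ := hs t ht
  have h1 := substConfig_apply S₀ ω₀ (letterPos c) ⟨s * t, h⟩
  rwa [hfix, fixed_letterPos hS₀ hfix, e, ← mul_assoc] at h1

/-- Every core pattern of the fixed point occurs in the supertiles of a common order of all
letters. -/
theorem exists_order_core_patterns (hS₀ : IsHeisRule S₀)
    (hlim : ∀ (n : ℕ) (ξ : lattice), cell^[n] ξ = 1 →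
      ω₀ ξ = (substConfig S₀)^[n] (fun _ => Letter.a) ξ) :
    ∃ m : ℕ, ∀ (x : lattice) (c : Letter), ∃ γ : lattice, ∀ t ∈ core,
      cell^[m] (γ * t) = 1 ∧ (substConfig S₀)^[m] (fun _ => c) (γ * t) = ω₀ (x * t) := by
  -- The pattern lies in the N-th supertile at e. The bound N + 1 leaves at least one substitution
  -- to turn the letter c at e into `a`.
  have each : ∀ x : lattice, ∃ N : ℕ, ∀ m ≥ N, ∀ c : Letter, ∀ t ∈ core,
      cell^[m] (x * t) = 1 ∧ (substConfig S₀)^[m] (fun _ => c) (x * t) = ω₀ (x * t) := by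
    intro x
    obtain ⟨N, hN⟩ := eventually_iterate_cell_eq_one_of_finite (finite_core.image (x * ·))
    refine ⟨N + 1, fun m hm c t ht => ⟨hN m (by omega) _ ⟨t, ht, rfl⟩, ?_⟩⟩
    obtain ⟨l, rfl⟩ := Nat.exists_eq_add_of_le hm
    have h1 : cell^[N] (x * t) = 1 := hN N le_rfl _ ⟨t, ht, rfl⟩
    rw [add_assoc, Function.iterate_add_apply, hlim _ _ h1]
    refine iterate_substConfig_congr S₀ N ?_
    rw [h1, add_comm 1 l, Function.iterate_succ_apply', substConfig_one hS₀]
  -- Indexing the orders by the finitely many patterns, not by positions x, allows a maximum;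
  -- patterns that do not occur receive order 0.
  have pattern : ∀ f : core → Letter, ∃ N : ℕ, (∃ x : lattice, ∀ t : core, ω₀ (x * t) = f t) →
      ∀ m ≥ N, ∃ γ : lattice, ∀ c : Letter, ∀ t : core,
        cell^[m] (γ * t) = 1 ∧ (substConfig S₀)^[m] (fun _ => c) (γ * t) = f t := by
    intro f
    by_cases hf : ∃ x : lattice, ∀ t : core, ω₀ (x * t) = f t
    · obtain ⟨x, hx⟩ := hf
      obtain ⟨N, hN⟩ := each x
      exact ⟨N, fun _ m hm => ⟨x, fun c t => by rw [← hx t]; exact hN m hm c t t.2⟩⟩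
    · exact ⟨0, fun h => absurd h hf⟩
  choose N hN using pattern
  have : Finite core := finite_core.to_subtype
  obtain ⟨m, hm⟩ := (Set.finite_range N).bddAbove
  refine ⟨m, fun x c => ?_⟩
  obtain ⟨γ, hγ⟩ := hN (fun t => ω₀ (x * t)) ⟨x, fun _ => rfl⟩ m (hm ⟨_, rfl⟩)
  exact ⟨γ, fun t ht => hγ c ⟨t, ht⟩⟩

/-- The ball pattern is part of Sⁿ applied to a core pattern, and that core pattern already occurs
in Sᵐ(c). -/
theorem exists_ball_pattern_in_supertile (hfix : substConfig S₀ ω₀ = ω₀) {m : ℕ}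
    (hm : ∀ (x : lattice) (c : Letter), ∃ γ : lattice, ∀ t ∈ core,
      cell^[m] (γ * t) = 1 ∧ (substConfig S₀)^[m] (fun _ => c) (γ * t) = ω₀ (x * t))
    {n : ℕ} {r : ℝ} (hr : 10 * r ≤ 4 ^ n) (x : lattice) (c : Letter) :
    ∃ γ : lattice, ∀ u ∈ ballOne latticeDist r, cell^[m + n] (γ * u) = 1 ∧
      (substConfig S₀)^[m + n] (fun _ => c) (γ * u) = ω₀ (x * u) := by
  obtain ⟨y, hy⟩ := exists_iterate_cell_mem_core n x hr
  obtain ⟨γ, hγ⟩ := hm y c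
  refine ⟨latticeD^[n] (γ * y⁻¹) * x, fun u hu => ?_⟩
  obtain ⟨h1, h2⟩ := hγ _ (hy u hu)
  rw [mul_inv_cancel_left] at h2
  rw [mul_assoc]
  refine ⟨?_, ?_⟩
  · rw [Function.iterate_add_apply, iterate_cell_mul, mul_assoc, h1]
  · rw [add_comm m n, Function.iterate_add_apply, ← iterate_substConfig_transfer S₀ n (ω := ω₀) _
      (by rw [← h2, mul_assoc]), Function.iterate_fixed hfix]

theorem exists_eq_of_mem_dictionary (hS₀ : IsHeisRule S₀) (hfix : substConfig S₀ ω₀ = ω₀)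
    (hlim : ∀ (n : ℕ) (ξ : lattice), cell^[n] ξ = 1 →
      ω₀ ξ = (substConfig S₀)^[n] (fun _ => Letter.a) ξ) {P : Patch lattice Letter}
    (hP : P ∈ dictionary (substSubshift S₀)) :
    ∃ x : lattice, ∀ η ∈ patchSupport P, P η = some (ω₀ (x * η)) := by
  obtain ⟨hfin, ω, hω, γ, hγ⟩ := hP
  obtain ⟨δ, hδ⟩ := (mem_substSubshift_iff hS₀ hfix hlim).1 hω _ (hfin.image (γ * ·))
  refine ⟨δ * γ, fun η hη => ?_⟩
  rw [← hγ η hη, mul_assoc, ← hδ _ ⟨η, hη, rfl⟩]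
  rfl

/-- The R-ball at x contains the whole supertile of order k through x, and that supertile contains
every pattern of radius r. With 4ⁿ ≤ 10r < 4ⁿ⁺¹ and k = m + n + 1, its diameter bound is 4·4ᵏ =
16·4ᵐ·4ⁿ ≤ 160·4ᵐ·r. -/
theorem isLinearlyRepetitive_substSubshift (hS₀ : IsHeisRule S₀)
    (hfix : substConfig S₀ ω₀ = ω₀)
    (hlim : ∀ (n : ℕ) (ξ : lattice), cell^[n] ξ = 1 →
      ω₀ ξ = (substConfig S₀)^[n] (fun _ => Letter.a) ξ) :
    IsLinearlyRepetitive latticeDist (substSubshift S₀) := by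
  obtain ⟨m, hm⟩ := exists_order_core_patterns hS₀ hlim
  refine ⟨160 * 4 ^ m, ?_, fun r R hr hR P hP hPs Q hQ hQs => ?_⟩
  · have : (1 : ℝ) ≤ 4 ^ m := one_le_pow₀ (by norm_num)
    linarith
  obtain ⟨n, hn1, hn2⟩ := exists_nat_pow_near (by linarith : (1 : ℝ) ≤ 10 * r)
    (by norm_num : (1 : ℝ) < 4)
  obtain ⟨x, hx⟩ := exists_eq_of_mem_dictionary hS₀ hfix hlim hP
  obtain ⟨y, hy⟩ := exists_eq_of_mem_dictionary hS₀ hfix hlim hQ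
  set k := m + (n + 1) with hk
  obtain ⟨γ, hγ⟩ := exists_ball_pattern_in_supertile hfix hm hn2.le y (ω₀ (cell^[k] x))
  have hkR : 4 * 4 ^ k ≤ R := by
    refine le_trans ?_ hR
    have : (0 : ℝ) < 4 ^ m := by positivity
    have e : (4 : ℝ) * 4 ^ k = 4 ^ m * (16 * 4 ^ n) := by rw [hk]; ring
    rw [e, mul_comm (160 : ℝ), mul_assoc]
    exact mul_le_mul_of_nonneg_left (by linarith) this.le
  have hcell : ∀ u ∈ ballOne latticeDist r,
      cell^[k] (latticeD^[k] (cell^[k] x) * (γ * u)) = cell^[k] x := fun u hu => by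
    rw [iterate_cell_mul, (hγ u hu).1, mul_one]
  refine ⟨x⁻¹ * latticeD^[k] (cell^[k] x) * γ, fun u hu => ?_⟩
  rw [hQs] at hu
  have hmem : x⁻¹ * (latticeD^[k] (cell^[k] x) * (γ * u)) ∈ ballOne latticeDist R :=
    inv_mul_mem_ballOne (hcell u hu).symm hkR
  rw [hy u (hQs ▸ hu), mul_assoc, mul_assoc, hx _ (hPs ▸ hmem), mul_inv_cancel_left,
    ← (hγ u hu).2]
  congr 1
  rw [iterate_substConfig_transfer S₀ k (ρ := ω₀) (cell^[k] x) (by rw [(hγ u hu).1, mul_one]),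
    Function.iterate_fixed hfix]

/-! ### Periodic approximation -/

/-- With n = m + k and r = 4ᵏ/10, the two systems have the same patterns on r-balls. This gives
distance at most 1/(r + 1) < 1/r = 10·4ᵐ/4ⁿ. -/
theorem exists_configHausdorffDist_le (hS₀ : IsHeisRule S₀) (hfix : substConfig S₀ ω₀ = ω₀)
    (hlim : ∀ (n : ℕ) (ξ : lattice), cell^[n] ξ = 1 →
      ω₀ ξ = (substConfig S₀)^[n] (fun _ => Letter.a) ξ) :
    ∃ C : ℝ, 0 < C ∧ ∃ M₁ : ℕ, ∀ (c : Letter) (n : ℕ), M₁ ≤ n →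
      configHausdorffDist latticeDist
        (orb ((substConfig S₀)^[n] fun _ => c)) (substSubshift S₀) ≤ C / 4 ^ n := by
  obtain ⟨m, hm⟩ := exists_order_core_patterns hS₀ hlim
  refine ⟨10 * 4 ^ m, by positivity, m, fun c n hn => ?_⟩
  obtain ⟨k, rfl⟩ := Nat.exists_eq_add_of_le hn
  set r : ℝ := 4 ^ k / 10 with hr
  have hr0 : 0 < r := by positivity
  have hrk : 10 * r ≤ 4 ^ k := by rw [hr]; linarith
  have hrn : 10 * r ≤ 4 ^ (m + k) := hrk.trans (pow_le_pow_right₀ (by norm_num) (by omega))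
  refine (configHausdorffDist_le hr0.le ?_ ?_).trans ?_
  · rintro _ ⟨g, rfl⟩
    -- The ball sees only supertiles of the letter c with indices in y · `core`, and ω₀ carries c on
    -- γ · `core`, so γy⁻¹ moves the pattern into ω₀.
    obtain ⟨y, hy⟩ := exists_iterate_cell_mem_core (m + k) g⁻¹ hrn
    obtain ⟨γ, hγ⟩ := exists_core_pattern_const hS₀ hfix c
    refine ⟨shift (latticeD^[m + k] (γ * y⁻¹) * g⁻¹)⁻¹ ω₀, ?_, fun u hu => ?_⟩
    · rw [substSubshift_eq_closure_orb hS₀ hfix hlim]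
      exact subset_closure ⟨_, rfl⟩
    · simp only [shift, inv_inv]
      rw [iterate_substConfig_transfer S₀ (m + k) (ρ := ω₀) (γ * y⁻¹)
        (by rw [mul_assoc, hγ _ (hy u hu)]), Function.iterate_fixed hfix, mul_assoc]
  · intro ρ hρ
    obtain ⟨x, hx⟩ := (mem_substSubshift_iff hS₀ hfix hlim).1 hρ _ (finite_ballOne r)
    obtain ⟨γ, hγ⟩ := exists_ball_pattern_in_supertile hfix hm hrk x c
    refine ⟨_, ⟨γ⁻¹, rfl⟩, fun u hu => ?_⟩
    rw [hx u hu, ← (hγ u hu).2]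
    simp [shift]
  · have e : 10 * 4 ^ m / 4 ^ (m + k) = 1 / r := by
      rw [hr, pow_add]
      field_simp
    rw [e]
    exact one_div_le_one_div_of_le hr0 (by linarith)

end FixedPoint

end Heis

end

theorem mainTheorem8 (S₀ : Letter → Heis.block → Letter) (hS₀ : IsHeisRule S₀) :
    -- (a)
    (IsSubshift (Heis.substSubshift S₀) ∧
      IsStronglyAperiodic (Heis.substSubshift S₀) ∧
      IsLinearlyRepetitive Heis.latticeDist (Heis.substSubshift S₀)) ∧
    -- (b)
    Heis.IsTestingDomain (Heis.levelSet 1 {1} ∩ Heis.lattice) ∧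
    -- (c)
    (IsPeriodicallyApproximable Heis.latticeDist (Heis.substSubshift S₀) ∧
      (∀ (c : Letter) (n : ℕ), IsPeriodicConfig ((Heis.substConfig S₀)^[n] fun _ => c)) ∧
      ∃ C : ℝ, 0 < C ∧ ∃ M₁ : ℕ, ∀ (c : Letter) (n : ℕ), M₁ ≤ n →
        configHausdorffDist Heis.latticeDist
          (orb ((Heis.substConfig S₀)^[n] fun _ => c)) (Heis.substSubshift S₀) ≤ C / 4 ^ n) := by
  obtain ⟨ω₀, hfix, hlim⟩ := Heis.exists_substConfig_fixed hS₀
  have hcl := Heis.substSubshift_eq_closure_orb hS₀ hfix hlim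
  obtain ⟨C, hC, M₁, hM⟩ := Heis.exists_configHausdorffDist_le hS₀ hfix hlim
  have hper := fun c n => Heis.isPeriodicConfig_iterate_substConfig S₀ n c
  refine ⟨⟨⟨?_, ?_, ?_⟩, ?_, Heis.isLinearlyRepetitive_substSubshift hS₀ hfix hlim⟩,
    Heis.isTestingDomain_levelSet_one,
    ⟨fun n => (Heis.substConfig S₀)^[n] fun _ => Letter.a, hper Letter.a, ?_⟩, hper,
    C, hC, M₁, hM⟩
  · rw [hcl]
    exact ⟨_, subset_closure ⟨1, rfl⟩⟩
  · rw [hcl]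
    exact isClosed_closure
  · rw [hcl]
    exact fun γ ω hω => Heis.shift_mem_closure_orb γ hω
  -- Every translate of ω₀ is a translate of an n-fold image for each n. This passes to the orbit
  -- closure because `substImage` is closed.
  · intro ω hω
    rw [hcl] at hω
    exact Heis.stab_eq_of_forall_mem_substImage hS₀ fun n =>
      closure_minimal (Heis.orb_subset_substImage hfix n) (Heis.isClosed_substImage S₀ n) hω
  · have h0 : Filter.Tendsto (fun n : ℕ => C / 4 ^ n) Filter.atTop (nhds 0) := by
      have := (tendsto_pow_atTop_nhds_zero_of_lt_one (r := (1 / 4 : ℝ)) (by norm_num)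
        (by norm_num)).const_mul C
      simpa [div_eq_mul_inv] using this
    refine tendsto_of_tendsto_of_tendsto_of_le_of_le' tendsto_const_nhds h0
      (Filter.Eventually.of_forall fun n => configHausdorffDist_nonneg _ _)
      (Filter.eventually_atTop.2 ⟨M₁, fun n hn => hM Letter.a n hn⟩)
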